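/- **Setting.** Let $a_n<b_n\le a_{n+1}$ $(n\in\mathbb Z)$ be real numbers such that $L_1:=b_n-a_n$ and $L_2:=a_{n+1}-b_n$ do not depend on $n$; put $L:=L_1+L_2=a_{n+1}-a_n$ and $\tilde\Omega:=\{\xi\in\mathbb R^3:\ \xi_1+\xi_2+\xi_3=0,\ \xi_2-\xi_1\in\{a_n,b_n\}\text{ for some }n\}$. Intervals are bounded, half-open and non-degenerate; $c(I)$ is the center of $I$, and $cI$ is the interval with the same center and $c$ times the length. *Tiles.* A tile is a rectangle $I\times\omega$ of area $1$. A tri-tile $s$ (with constant $B$) consists of intervals $I_s,\omega_{s_1},\omega_{s_2},\omega_{s_3}$ such that $s_j:=I_s\times\omega_{s_j}$ are tiles, the distance from $\omega_{s_1}\times\omega_{s_2}\times\omega_{s_3}$ to $\tilde\Omega$ is comparable to $|I_s|^{-1}$ (up to the factor $B$), and there is exactly one $n$ with $a_n<\xi_2-\xi_1<b_n$ on $\omega_{s_1}\times\omega_{s_2}$; for a collection $\mathbf Q$ of tri-tiles, $\mathbf Q_n$ is the set of those with this $n$. A set of intervals is a grid (with constant $A$) if for each $k\in\mathbb Z$ its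 members of length in $[2^{k-1},2^{k+1}]$ cover each point at most $A$ times. A collection is a set $\mathbf Q$ of tri-tiles such that $\{I_s\}_{s\in\mathbf Q}$ and $\{\omega_{s_j}\}_{s\in\mathbf Q,\,j}$ are grids. *Order, rank one.* For tiles $P'=I'\times\omega'$, $P=I\times\omega$: $P'<P$ if $I'\subsetneq I$ and $3\omega\subset3\omega'$; $P'\le P$ if $P'<P$ or $P'=P$; $P'\lesssim P$ if $I'\subset I$ and $10^7\omega\subset10^7\omega'$; $P'\lesssim' P$ if $P'\lesssim P$ and $P'\not\le P$. A set of tri-tiles is of rank one if for all $s,s'$ in it and all $j$: $s\ne s'$ implies $s_j\ne s'_j$; $s'_j\le s_j$ implies $s'_i\lesssim s_i$ for all $i$, and, if moreover $10^9|I_{s'}|<|I_s|$, also $s'_i\lesssim' s_i$ for all $i\ne j$. *Reference set.* $\mathbf S:=\{s\in\mathbf Q_0:\ \omega_{s_1}\subset[-3L_2,3L_2]\}$. We say that $\mathbf Q$ is translation complete if for some $N\in\mathbb N$ it is the union over $-N\le i,j\le N$ of the frequency translates of $\mathbf S$ by the vectors $(iL,jL,-(i+j)L)$. *Wave packets.*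 For each $j$ and each tile $P=I\times\omega$ that is the $j$-th tile of some $s\in\mathbf Q$, $\Phi_P=\Phi_{j,P}$ is a smooth function on $\mathbb R$ with Fourier support in $\tfrac9{10}\omega$ and $|(e^{-ic(\omega)\cdot}\Phi_P)^{(i)}(x)|\le K_{i,M}|I|^{-1/2-i}(1+|x-c(I)|/|I|)^{-M}$ for all $i,M\in\mathbb N$. Put $$\Lambda_{\mathbf Q}(f_1,f_2,f_3):=\sum_{n\in\mathbb Z}\sum_{s\in\mathbf Q_n}|I_s|^{-1/2}\left|\langle f_1,\Phi_{s_1}\rangle\langle f_2,\Phi_{s_2}\rangle\langle f_{3,n},\Phi_{s_3}\rangle\right|.$$ *Trees.* A $k$-tree of a collection $\mathbf P$ with top $t$ is a set $\mathbf T\subset\mathbf P_n$, for some $n$, with $t\in\mathbf P_n$ and $s_k\le t_k$ for all $s\in\mathbf T$; $I_{\mathbf T}:=I_t$. Put $\vec{\mathbf T}^{\,k}:=\{s\in\mathbf Q:\ s_k=s'_k\text{ for some }s'\in\mathbf T\}$, $\vec{\mathbf T}^{\,1,2}:=\overrightarrow{(\vec{\mathbf T}^{\,1})}^{\,2}$,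 and, for $\{j,l\}=\{1,2\}$, $$m_j(\mathbf T):=\sum_{s\in\vec{\mathbf T}^{\,l}}|\langle f_j,\Phi_{s_j}\rangle|^2,\qquad m_3(\mathbf T):=\sum_n\sum_{s\in\vec{\mathbf T}^{\,1,2}\cap\mathbf Q_n}|\langle f_{3,n},\Phi_{s_3}\rangle|^2 .$$ *Sizes.* $\mathrm{size}_j:=\sup_{\mathbf T}\,(m_j(\mathbf T)/|I_{\mathbf T}|)^{1/2}$, over all $k$-trees $\mathbf T$ with $k\ne j$, of $\mathbf Q$ if $j\in\{1,2\}$ and of $\mathbf S$ if $j=3$. *Energies.* A finite family $D$ of trees is strongly $j$-disjoint if for distinct $\mathbf T,\mathbf T'\in D$ and $s\in\mathbf T$, $s'\in\mathbf T'$: $s_j\cap s'_j=\emptyset$, and $I_{s'}\cap I_{\mathbf T}=\emptyset$ whenever $|\omega_{s_j}|<|\omega_{s'_j}|$ and $2\omega_{s_j}\cap2\omega_{s'_j}\ne\emptyset$. $\mathrm{energy}_j:=\sup\,2^r\big(\sum_{\mathbf T\in D}|I_{\mathbf T}|\big)^{1/2}$, over all $r\in\mathbb Z$, $k\ne j$ and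 strongly $j$-disjoint families $D$ of $k$-trees of $\mathbf S$ such that every $\mathbf T\in D$ satisfies $m_j(\mathbf T)\ge2^{2r}|I_{\mathbf T}|$ and $m_j(\mathbf T')\le2^{2r+2}|I_{\mathbf T'}|$ for all $k$-trees $\mathbf T'\subset\mathbf T$ of $\mathbf S$. **Theorem.** Let $A$, $B$ be given. There is a constant $\kappa=\kappa(A,B)$ such that for all $\theta_1,\theta_2,\theta_3>0$ with $\theta_1+\theta_2+\theta_3=1$ there is a constant $C=C(\theta,A,B)$ with the following property. Suppose that $L_2\ge\kappa L_1$ and that $\mathbf Q$ is a finite, translation complete collection of tri-tiles (with the constants $A$, $B$) such that every $\mathbf Q_n$ is of rank one. Then for all wave packets as above, and all functions $f_1$, $f_2$ and sequences of functions $f_3=(f_{3,n})_{n\in\mathbb Z}$ whose pairings with the wave packets in $\Lambda_{\mathbf Q}$ converge absolutely (for instance Schwartz functions), $$\Lambda_{\mathbf Q}(f_1,f_2,f_3)\le C\prod_{j=1}^3\mathrm{energy}_j^{\,1-\theta_j}\,\mathrm{size}_j^{\,\theta_j}.$$ -/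

import Mathlib

open scoped ENNReal NNReal

noncomputable section

namespace BilinearSquare

/-! Indices: the paper's `1, 2, 3` are `0, 1, 2 : Fin 3`. -/

/-! ### Intervals, tiles, tri-tiles -/

/-- A bounded non-degenerate interval `[lo, hi)` of the real line. -/
@[ext] structure Ivl where
  lo : ℝ
  hi : ℝ
  lt : lo < hi

namespace Ivl

def len (I : Ivl) : ℝ := I.hi - I.lo

def center (I : Ivl) : ℝ := (I.lo + I.hi) / 2

def toSet (I : Ivl) : Set ℝ := Set.Ico I.lo I.hi

/-- `c I`: the interval with the center of `I` and `c` times its length. -/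
def dil (c : ℝ) (I : Ivl) : Set ℝ :=
  Set.Ico (I.center - c * I.len / 2) (I.center + c * I.len / 2)

def shift (u : ℝ) (I : Ivl) : Ivl := ⟨I.lo + u, I.hi + u, by linarith [I.lt]⟩

end Ivl

/-- A tile: a rectangle `I × ω` of area one in the phase plane. -/
@[ext] structure Tile where
  I : Ivl
  ω : Ivl
  area : I.len * ω.len = 1

def Tile.rect (P : Tile) : Set (ℝ × ℝ) := P.I.toSet ×ˢ P.ω.toSet

/-- The data of a tri-tile: a space interval and three frequency intervals, each of which makes
a tile with it. The geometric conditions are in `IsTriTile`. -/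
@[ext] structure TriTile where
  I : Ivl
  ω : Fin 3 → Ivl
  area : ∀ j, I.len * (ω j).len = 1

def TriTile.tile (s : TriTile) (j : Fin 3) : Tile := ⟨s.I, s.ω j, s.area j⟩

/-- The frequency cube `ω₁ × ω₂ × ω₃` of a tri-tile. -/
def TriTile.cube (s : TriTile) : Set (Fin 3 → ℝ) := {ξ | ∀ j, ξ j ∈ (s.ω j).toSet}

/-- The frequency translation of a tri-tile by a vector `u` of `ℝ³`. -/
def TriTile.translate (u : Fin 3 → ℝ) (s : TriTile) : TriTile where
  I := s.I
  ω := fun j => (s.ω j).shift (u j)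
  area := fun j => by
    have h := s.area j
    simp only [Ivl.len, Ivl.shift, add_sub_add_right_eq_sub] at h ⊢
    exact h

/-! ### The order relations between tiles -/

/-- `P' < P`. -/
def Tile.Below (P' P : Tile) : Prop :=
  P'.I.toSet ⊂ P.I.toSet ∧ P.ω.dil 3 ⊆ P'.ω.dil 3

/-- `P' ≤ P`. -/
def Tile.BelowEq (P' P : Tile) : Prop := P'.Below P ∨ P' = P

/-- `P' ≲ P`. -/
def Tile.Near (P' P : Tile) : Prop :=
  P'.I.toSet ⊆ P.I.toSet ∧ P.ω.dil (10 ^ 7) ⊆ P'.ω.dil (10 ^ 7)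

/-- `P' ≲' P`. -/
def Tile.NearNotBelow (P' P : Tile) : Prop := P'.Near P ∧ ¬ P'.BelowEq P

/-! ### The strips -/

/-- The intervals `[aₙ, bₙ]`: disjoint, all of the same length, all at the same distance from the
next one. -/
structure Strips where
  a : ℤ → ℝ
  b : ℤ → ℝ
  lt : ∀ n, a n < b n
  le : ∀ n, b n ≤ a (n + 1)
  len_eq : ∀ n, b n - a n = b (n - 1) - a (n - 1)
  gap_eq : ∀ n, a (n + 1) - b n = a n - b (n - 1)

namespace Strips

/-- The common length of the intervals. -/
def L₁ (S : Strips) : ℝ := S.b 0 - S.a 0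

/-- The common distance of consecutive intervals. -/
def L₂ (S : Strips) : ℝ := S.a 1 - S.b 0

/-- The period `L₁ + L₂ = aₙ₊₁ - aₙ` of the family of strips. -/
def period (S : Strips) : ℝ := S.L₁ + S.L₂

/-- The singular set in the plane `ξ₁ + ξ₂ + ξ₃ = 0`. -/
def singular (S : Strips) : Set (Fin 3 → ℝ) :=
  {ξ | ξ 0 + ξ 1 + ξ 2 = 0 ∧ ∃ n, ξ 1 - ξ 0 = S.a n ∨ ξ 1 - ξ 0 = S.b n}

end Strips

/-- `s` belongs to the `n`-th strip: `aₙ < ξ₂ - ξ₁ < bₙ` on `ω₁ × ω₂`. -/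
def InStrip (S : Strips) (n : ℤ) (s : TriTile) : Prop :=
  ∀ x ∈ (s.ω 0).toSet, ∀ y ∈ (s.ω 1).toSet, S.a n < y - x ∧ y - x < S.b n

/-- `s` is a tri-tile for the strips `S`: its frequency cube is a Whitney cube of the complement
of the singular set (with constant `B`; the distance is that of the maximum norm) and it lies in
exactly one strip. -/
structure IsTriTile (S : Strips) (B : ℝ) (s : TriTile) : Prop where
  dist_ge : ∀ ξ ∈ s.cube, ∀ η ∈ S.singular, B⁻¹ * s.I.len⁻¹ ≤ dist ξ η
  dist_le : ∃ ξ ∈ s.cube, ∃ η ∈ S.singular, dist ξ η ≤ B * s.I.len⁻¹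
  strip : ∃! n, InStrip S n s

/-- A grid with constant `A`: the intervals of comparable length cover no point more than `A`
times. -/
def IsGrid (A : ℕ) (𝓘 : Set Ivl) : Prop :=
  ∀ (k : ℤ) (x : ℝ),
    {I ∈ 𝓘 | (2 : ℝ) ^ (k - 1) ≤ I.len ∧ I.len ≤ (2 : ℝ) ^ (k + 1) ∧ x ∈ I.toSet}.encard ≤ A

/-- A finite collection of tri-tiles. -/
structure IsCollection (S : Strips) (A : ℕ) (B : ℝ) (Q : Finset TriTile) : Prop where
  triTile : ∀ s ∈ Q, IsTriTile S B s
  grid_space : IsGrid A {I | ∃ s ∈ Q, I = s.I}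
  grid_freq : IsGrid A {w | ∃ s ∈ Q, ∃ j, w = s.ω j}

/-- The sub-collection of the tri-tiles of the `n`-th strip. -/
def strip (S : Strips) (Q : Finset TriTile) (n : ℤ) : Finset TriTile :=
  open Classical in Q.filter fun s => InStrip S n s

/-- Rank one, in the sense of Muscalu, Tao and Thiele. -/
structure IsRankOne (P : Finset TriTile) : Prop where
  tile_ne : ∀ s ∈ P, ∀ s' ∈ P, s ≠ s' → ∀ j, s.tile j ≠ s'.tile j
  near : ∀ s ∈ P, ∀ s' ∈ P, ∀ j, (s'.tile j).BelowEq (s.tile j) →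
    ∀ i, (s'.tile i).Near (s.tile i)
  lacunary : ∀ s ∈ P, ∀ s' ∈ P, ∀ j, (s'.tile j).BelowEq (s.tile j) →
    10 ^ 9 * s'.I.len < s.I.len → ∀ i, i ≠ j → (s'.tile i).NearNotBelow (s.tile i)

/-- The reference set: the tri-tiles of the strip `0` with `ω₁ ⊆ [-3 L₂, 3 L₂]`. -/
def refSet (S : Strips) (Q : Finset TriTile) : Finset TriTile :=
  open Classical in
  (strip S Q 0).filter fun s => (s.ω 0).toSet ⊆ Set.Icc (-(3 * S.L₂)) (3 * S.L₂)

/-- The translation `τ` by `(i L, j L, -(i + j) L)`, where `L` is the period of the strips. -/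
def latticeTranslate (S : Strips) (i j : ℤ) (s : TriTile) : TriTile :=
  s.translate ![i * S.period, j * S.period, -((i + j) * S.period)]

/-- `Q` is the union of the translates, with `-N ≤ i, j ≤ N`, of its reference set. -/
def IsTranslationComplete (S : Strips) (Q : Finset TriTile) : Prop :=
  ∃ N : ℕ, ∀ s, s ∈ Q ↔
    ∃ i ∈ Set.Icc (-(N : ℤ)) N, ∃ j ∈ Set.Icc (-(N : ℤ)) N, ∃ s' ∈ refSet S Q,
      s = latticeTranslate S i j s'

/-! ### Wave packets -/

/-- `φ` is a wave packet on the tile `P`, with constants `K`. The Fourier transform is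
`ξ ↦ ∫ e^{-iξx} φ(x) dx`. -/
structure IsWavePacket (K : ℕ → ℕ → ℝ) (P : Tile) (φ : ℝ → ℂ) : Prop where
  smooth : ContDiff ℝ (⊤ : ℕ∞) φ
  fourier_support : ∀ ξ : ℝ, 9 / 10 * P.ω.len / 2 < |ξ - P.ω.center| →
    ∫ x : ℝ, Complex.exp (-(Complex.I * ξ * x)) * φ x = 0
  decay : ∀ (i M : ℕ) (x : ℝ),
    ‖iteratedDeriv i (fun y : ℝ => Complex.exp (-(Complex.I * P.ω.center * y)) * φ y) x‖ ≤
      K i M * P.I.len ^ (-(1 / 2 : ℝ) - i) * ((1 + |x - P.I.center| / P.I.len) ^ M)⁻¹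

/-- The pairing `⟨f, φ⟩`. -/
def pairing (f φ : ℝ → ℂ) : ℂ := ∫ x, f x * (starRingEnd ℂ) (φ x)

/-- The integral defining `⟨f, φ⟩` converges. -/
def Pairable (f φ : ℝ → ℂ) : Prop :=
  MeasureTheory.Integrable fun x => f x * (starRingEnd ℂ) (φ x)

/-- A choice of wave packets; `Φ j P` is the one that the `j`-th function is tested against on the
tile `P`. -/
abbrev Packets := Fin 3 → Tile → ℝ → ℂ

/-! ### The trilinear form -/

/-- The form `Λ_Q(f, g, h)`. The sum over `n` has finitely many non-zero terms. -/
def form (S : Strips) (Φ : Packets) (Q : Finset TriTile) (f g : ℝ → ℂ) (h : ℤ → ℝ → ℂ) : ℝ :=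
  ∑' n : ℤ, ∑ s ∈ strip S Q n,
    s.I.len ^ (-(1 / 2) : ℝ) *
      ‖pairing f (Φ 0 (s.tile 0)) * pairing g (Φ 1 (s.tile 1)) * pairing (h n) (Φ 2 (s.tile 2))‖

/-! ### Trees and vectorized trees -/

/-- `T` is a `k`-tree of the collection `P`, with top `t`. -/
def IsTree (S : Strips) (P : Finset TriTile) (k : Fin 3) (t : TriTile) (T : Finset TriTile) :
    Prop :=
  ∃ n, t ∈ strip S P n ∧ T ⊆ strip S P n ∧ ∀ s ∈ T, (s.tile k).BelowEq (t.tile k)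

/-- The `k`-vectorized tree of `T`: all tri-tiles of `Q` with the same `k`-th tile as some
tri-tile of `T`. -/
def vec (Q : Finset TriTile) (k : Fin 3) (T : Finset TriTile) : Finset TriTile :=
  open Classical in Q.filter fun s => ∃ s' ∈ T, s.tile k = s'.tile k

/-- The `(1,2)`-vectorized tree of `T`. -/
def vec₁₂ (Q : Finset TriTile) (T : Finset TriTile) : Finset TriTile := vec Q 1 (vec Q 0 T)

/-- `∑ |⟨f, Φ_{s_j}⟩|²` over the `l`-vectorized tree of `T`. -/
def mass (Φ : Packets) (Q : Finset TriTile) (j l : Fin 3) (f : ℝ → ℂ) (T : Finset TriTile) : ℝ :=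
  ∑ s ∈ vec Q l T, ‖pairing f (Φ j (s.tile j))‖ ^ 2

/-- `∑ₙ ∑ |⟨hₙ, Φ_{s_3}⟩|²` over the tri-tiles of the `n`-th strip in the `(1,2)`-vectorized tree
of `T`. -/
def mass₃ (S : Strips) (Φ : Packets) (Q : Finset TriTile) (h : ℤ → ℝ → ℂ) (T : Finset TriTile) :
    ℝ :=
  ∑' n : ℤ, ∑ s ∈ strip S (vec₁₂ Q T) n, ‖pairing (h n) (Φ 2 (s.tile 2))‖ ^ 2

/-! ### Sizes and energies -/

/-- The supremum of `(|I_T|⁻¹ m(T))^{1/2}` over all `k`-trees `T` of `P` with `k ≠ j`. -/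
def treeSup (S : Strips) (P : Finset TriTile) (j : Fin 3) (m : Finset TriTile → ℝ) : ℝ≥0∞ :=
  ⨆ (k : Fin 3) (_ : k ≠ j) (t : TriTile) (T : Finset TriTile) (_ : IsTree S P k t T),
    ENNReal.ofReal (Real.sqrt (t.I.len⁻¹ * m T))

/-- Strong `j`-disjointness of a family of trees, each given with its top. -/
def StronglyDisjoint (j : Fin 3) (D : Finset (TriTile × Finset TriTile)) : Prop :=
  ∀ p ∈ D, ∀ p' ∈ D, p ≠ p' → ∀ s ∈ p.2, ∀ s' ∈ p'.2,
    Disjoint (s.tile j).rect (s'.tile j).rect ∧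
      ((s.ω j).len < (s'.ω j).len → ((s.ω j).dil 2 ∩ (s'.ω j).dil 2).Nonempty →
        Disjoint s'.I.toSet p.1.I.toSet)

/-- The families of trees that enter the energy at the level `2 ^ r`: strongly `j`-disjoint
`k`-trees `T` of the reference set with `m(T) ≥ 2^{2r} |I_T|`, and `m(T') ≤ 2^{2r+2} |I_{T'}|` for
all sub-trees `T'` of `T`. -/
structure IsEnergyFamily (S : Strips) (Q : Finset TriTile) (j k : Fin 3)
    (m : Finset TriTile → ℝ) (r : ℤ) (D : Finset (TriTile × Finset TriTile)) : Prop where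
  tree : ∀ p ∈ D, IsTree S (refSet S Q) k p.1 p.2
  disjoint : StronglyDisjoint j D
  lower : ∀ p ∈ D, (2 : ℝ) ^ (2 * r) * p.1.I.len ≤ m p.2
  upper : ∀ p ∈ D, ∀ (t' : TriTile) (T' : Finset TriTile), T' ⊆ p.2 →
    IsTree S (refSet S Q) k t' T' → m T' ≤ (2 : ℝ) ^ (2 * r + 2) * t'.I.len

/-- The supremum of `2 ^ r (∑_{T ∈ D} |I_T|)^{1/2}` over all levels and all such families of
`k`-trees with `k ≠ j`. -/
def treeEnergy (S : Strips) (Q : Finset TriTile) (j : Fin 3) (m : Finset TriTile → ℝ) : ℝ≥0∞ :=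
  ⨆ (k : Fin 3) (_ : k ≠ j) (r : ℤ) (D : Finset (TriTile × Finset TriTile))
    (_ : IsEnergyFamily S Q j k m r D),
    ENNReal.ofReal ((2 : ℝ) ^ r * Real.sqrt (∑ p ∈ D, p.1.I.len))

/-- The vectorized size of a function, for `{j, l} = {1, 2}`. -/
def vecSize (S : Strips) (Φ : Packets) (Q : Finset TriTile) (j l : Fin 3) (f : ℝ → ℂ) : ℝ≥0∞ :=
  treeSup S Q j (mass Φ Q j l f)

/-- The vectorized size of a sequence, for the index `3`; the trees are those of the reference
set. -/
def vecSize₃ (S : Strips) (Φ : Packets) (Q : Finset TriTile) (h : ℤ → ℝ → ℂ) : ℝ≥0∞ :=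
  treeSup S (refSet S Q) 2 (mass₃ S Φ Q h)

/-- The vectorized energy of a function, for `{j, l} = {1, 2}`. -/
def vecEnergy (S : Strips) (Φ : Packets) (Q : Finset TriTile) (j l : Fin 3) (f : ℝ → ℂ) : ℝ≥0∞ :=
  treeEnergy S Q j (mass Φ Q j l f)

/-- The vectorized energy of a sequence, for the index `3`. -/
def vecEnergy₃ (S : Strips) (Φ : Packets) (Q : Finset TriTile) (h : ℤ → ℝ → ℂ) : ℝ≥0∞ :=
  treeEnergy S Q 2 (mass₃ S Φ Q h)

end BilinearSquare

end

open BilinearSquare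

/-! Translation completeness reduces the sum over all strips to a sum over the reference set. The
first tile of the translate of s by (i, j) depends only on i and the second only on j. Hence
Cauchy–Schwarz in (i, j) bounds the contribution of the orbit of s by |I_s|^{-1/2} ∏ W_j(s)^{1/2},
where W_1, W_2, W_3 are the sums of the squared coefficients over i, over j and over (i, j)
(`form_le_sum_weight`).

What remains is a trilinear sum over one rank one collection. The size-energy method of Muscalu, Tao
and Thiele applies to it once ∑_{s ∈ T} W_j(s) ≤ m_j(T) for all k-trees T with k ≠ j
(`isTreeMass_orbitMass`). For j = 1, 2 the orbits lie in the vectorized tree because the other one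
of the first two tiles stays fixed, and rank one keeps them apart. For j = 3, two tri-tiles of T
have a common translate in a common strip only if their k-th frequency centers differ by a multiple
of L. The tree condition keeps these centers less than 3 L₁ apart, so L₂ ≥ 2 L₁ rules this out for
distinct tri-tiles (`IsKTree.orbit_injective`).

For the single collection, split the grids into boundedly many sparse classes (`sum_le_of_sparse`).
In a sparse class, and at a density level τ, a greedy choice extracts strongly disjoint trees. The
energy bounds the total length of their tops by a multiple of energy²/τ, and all trees of the rest
have density at most τ (`exists_good`). The levels τ = (2^{-n} E_j)², taken for all j together, give
sets G n whose complements are covered at cost 4^n. On a tree inside G n with top t the form is at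
most |I_t| ∏ min(σ_j, 2^{-n} E_j), by Cauchy–Schwarz (`IsTreeMass.sum_weight_le`). Since ∑ (1 - θ_j)
= 2, the factor 4^n is exactly absorbed on interpolating each minimum, and one minimum is kept in a
sharper form that makes the sum over n converge (`exists_sum_levels_le`). -/

namespace BilinearSquare

/-! ### Intervals -/

namespace Ivl

theorem len_pos (I : Ivl) : 0 < I.len := sub_pos.2 I.lt

theorem lo_eq (I : Ivl) : I.lo = I.center - I.len / 2 := by
  simp only [center, len]; ring

theorem hi_eq (I : Ivl) : I.hi = I.center + I.len / 2 := by
  simp only [center, len]; ring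

theorem toSet_subset_iff (I J : Ivl) : I.toSet ⊆ J.toSet ↔ J.lo ≤ I.lo ∧ I.hi ≤ J.hi :=
  Set.Ico_subset_Ico_iff I.lt

theorem len_le_of_subset {I J : Ivl} (h : I.toSet ⊆ J.toSet) : I.len ≤ J.len := by
  obtain ⟨h₁, h₂⟩ := (toSet_subset_iff I J).1 h
  simp only [len]; linarith

theorem dil_subset_iff {c : ℝ} (hc : 0 < c) (I J : Ivl) :
    J.dil c ⊆ I.dil c ↔ |J.center - I.center| ≤ c / 2 * (I.len - J.len) := by
  have h : J.center - c * J.len / 2 < J.center + c * J.len / 2 := by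
    have := mul_pos hc J.len_pos
    linarith
  rw [dil, dil, Set.Ico_subset_Ico_iff h, abs_le]
  constructor
  · rintro ⟨h₁, h₂⟩
    constructor <;> nlinarith
  · rintro ⟨h₁, h₂⟩
    constructor <;> nlinarith

theorem abs_center_sub_le_of_dil {c : ℝ} {I J : Ivl} (h : (I.dil c ∩ J.dil c).Nonempty) :
    |I.center - J.center| ≤ c / 2 * (I.len + J.len) := by
  obtain ⟨x, ⟨h₁, h₂⟩, h₃, h₄⟩ := h
  rw [abs_le]
  constructor <;> nlinarith

theorem abs_center_sub_le_of_mem {I J : Ivl} {x : ℝ} (hI : x ∈ I.toSet) (hJ : x ∈ J.toSet) :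
    |I.center - J.center| ≤ (I.len + J.len) / 2 := by
  obtain ⟨h₁, h₂⟩ := hI
  obtain ⟨h₃, h₄⟩ := hJ
  rw [lo_eq] at h₁ h₃
  rw [hi_eq] at h₂ h₄
  rw [abs_le]
  constructor <;> linarith

theorem toSet_subset_dil_two (I : Ivl) : I.toSet ⊆ I.dil 2 := by
  intro x hx
  obtain ⟨h₁, h₂⟩ := hx
  rw [lo_eq] at h₁
  rw [hi_eq] at h₂
  have := I.len_pos
  constructor <;> linarith

/-- An interval that meets `J` without being contained in it contains an endpoint of `J`. -/
theorem subset_or_mem_of_not_disjoint {I J : Ivl} (h : ¬ Disjoint I.toSet J.toSet) :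
    I.toSet ⊆ J.toSet ∨ J.lo ∈ I.toSet ∨ J.hi ∈ I.toSet := by
  obtain ⟨x, ⟨h₁, h₂⟩, h₃, h₄⟩ := Set.not_disjoint_iff.1 h
  by_cases hlo : J.lo ≤ I.lo
  · by_cases hhi : I.hi ≤ J.hi
    · exact Or.inl ((toSet_subset_iff I J).2 ⟨hlo, hhi⟩)
    · exact Or.inr (Or.inr ⟨by linarith, by linarith⟩)
  · exact Or.inr (Or.inl ⟨by linarith, by linarith⟩)

/-- Two intervals are separated if their lengths or their positions are far apart. -/
def Sep (I J : Ivl) : Prop :=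
  10 ^ 10 * I.len ≤ J.len ∨ 10 ^ 10 * J.len ≤ I.len ∨
    2 * (I.len + J.len) ≤ |I.center - J.center|

theorem Sep.len_le_or {I J : Ivl} (h : I.Sep J)
    (hc : |I.center - J.center| < 2 * (I.len + J.len)) :
    10 ^ 10 * I.len ≤ J.len ∨ 10 ^ 10 * J.len ≤ I.len := by
  rcases h with h | h | h
  · exact Or.inl h
  · exact Or.inr h
  · exact absurd h (not_le.2 hc)

theorem Sep.len_le {I J : Ivl} (h : I = J ∨ I.Sep J)
    (hc : |I.center - J.center| < 2 * (I.len + J.len)) (hl : I.len < J.len) :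
    10 ^ 10 * I.len ≤ J.len := by
  rcases h with rfl | h
  · exact absurd hl (lt_irrefl _)
  · rcases h.len_le_or hc with h | h
    · exact h
    · linarith [J.len_pos]

theorem Sep.eq {I J : Ivl} (h : I = J ∨ I.Sep J)
    (hc : |I.center - J.center| < 2 * (I.len + J.len)) (h₁ : I.len < 10 ^ 10 * J.len)
    (h₂ : J.len < 10 ^ 10 * I.len) : I = J := by
  rcases h with h | h
  · exact h
  · rcases h.len_le_or hc with h | h <;> linarith

end Ivl

/-! ### Comparison of tri-tiles -/

namespace TriTile

theorem len_ω (s : TriTile) (j : Fin 3) : (s.ω j).len = s.I.len⁻¹ :=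
  eq_inv_of_mul_eq_one_right (s.area j)

theorem mul_len_le_iff (s s' : TriTile) (i j : Fin 3) (c : ℝ) :
    c * (s.ω i).len ≤ (s'.ω j).len ↔ c * s'.I.len ≤ s.I.len := by
  rw [len_ω, len_ω]
  have h := s.I.len_pos
  have h' := s'.I.len_pos
  rw [← div_eq_mul_inv, div_le_iff₀ h, inv_mul_eq_div, le_div_iff₀ h']

theorem len_lt_iff (s s' : TriTile) (i j : Fin 3) :
    (s.ω i).len < (s'.ω j).len ↔ s'.I.len < s.I.len := by
  rw [len_ω, len_ω, inv_lt_inv₀ s.I.len_pos s'.I.len_pos]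

theorem tile_eq_iff (s s' : TriTile) (j : Fin 3) :
    s.tile j = s'.tile j ↔ s.I = s'.I ∧ s.ω j = s'.ω j := by
  simp [tile, Tile.ext_iff]

variable {s t : TriTile} {k : Fin 3}

theorem subset_of_belowEq (h : (s.tile k).BelowEq (t.tile k)) : s.I.toSet ⊆ t.I.toSet := by
  rcases h with h | h
  · exact h.1.subset
  · rw [((tile_eq_iff s t k).1 h).1]

theorem abs_center_le_of_belowEq (h : (s.tile k).BelowEq (t.tile k)) :
    |(t.ω k).center - (s.ω k).center| ≤ 3 / 2 * ((s.ω k).len - (t.ω k).len) := by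
  rcases h with h | h
  · exact (Ivl.dil_subset_iff (by norm_num) _ _).1 h.2
  · rw [((tile_eq_iff s t k).1 h).2]
    simp

theorem belowEq_refl (s : TriTile) (k : Fin 3) : (s.tile k).BelowEq (s.tile k) := Or.inr rfl

theorem belowEq_of_subset (hI : s.I.toSet ⊆ t.I.toSet) (hl : s.I.len < t.I.len)
    (hc : |(t.ω k).center - (s.ω k).center| ≤ 3 / 2 * ((s.ω k).len - (t.ω k).len)) :
    (s.tile k).BelowEq (t.tile k) := by
  refine Or.inl ⟨⟨hI, fun h => ?_⟩, (Ivl.dil_subset_iff (by norm_num) _ _).2 hc⟩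
  exact absurd (Ivl.len_le_of_subset h) (not_le.2 hl)

end TriTile

theorem IsRankOne.abs_center_le {P : Finset TriTile} (hP : IsRankOne P) {s t : TriTile}
    (hs : s ∈ P) (ht : t ∈ P) {k : Fin 3} (h : (s.tile k).BelowEq (t.tile k)) (j : Fin 3) :
    |(t.ω j).center - (s.ω j).center| ≤ 10 ^ 7 / 2 * ((s.ω j).len - (t.ω j).len) :=
  (Ivl.dil_subset_iff (by norm_num) _ _).1 (hP.near t ht s hs k h j).2

/-- Lacunarity in terms of centers: off the index k of the tree, a much shorter tri-tile has its
frequency interval displaced from that of the top by more than its own length. Otherwise the j-th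
tiles would be ordered too. -/
theorem IsRankOne.lt_abs_center {P : Finset TriTile} (hP : IsRankOne P) {s t : TriTile}
    (hs : s ∈ P) (ht : t ∈ P) {k : Fin 3} (h : (s.tile k).BelowEq (t.tile k)) {j : Fin 3}
    (hj : j ≠ k) (hl : 10 ^ 9 * s.I.len < t.I.len) :
    3 / 2 * ((s.ω j).len - (t.ω j).len) < |(t.ω j).center - (s.ω j).center| := by
  by_contra hc
  refine (hP.lacunary t ht s hs k h hl j hj).2 ?_
  exact TriTile.belowEq_of_subset (TriTile.subset_of_belowEq h)
    (by linarith [s.I.len_pos]) (not_lt.1 hc)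

/-- Any two intervals of the same kind that occur in the collection are equal or separated. -/
structure IsSparse (P : Finset TriTile) : Prop where
  space : ∀ s ∈ P, ∀ s' ∈ P, s.I = s'.I ∨ s.I.Sep s'.I
  freq : ∀ s ∈ P, ∀ s' ∈ P, ∀ j, s.ω j = s'.ω j ∨ (s.ω j).Sep (s'.ω j)

/-- Equal frequency intervals force equal lengths in space. Two intervals of a sparse class with
equal length and a common point coincide, so the j-th tiles agree, and rank one identifies the
tri-tiles. -/
theorem IsSparse.eq_of_mem {P₀ P : Finset TriTile} (h₀ : IsSparse P₀) (hsub : P₀ ⊆ P)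
    (hP : IsRankOne P) {s s' : TriTile} (hs : s ∈ P₀) (hs' : s' ∈ P₀) {x : ℝ}
    (hx : x ∈ s.I.toSet) (hx' : x ∈ s'.I.toSet) {j : Fin 3} (hω : s.ω j = s'.ω j) : s = s' := by
  by_contra hne
  have hl : s.I.len = s'.I.len := by
    have := congrArg Ivl.len hω
    rwa [TriTile.len_ω, TriTile.len_ω, inv_inj] at this
  have hpos := s.I.len_pos
  have hI : s.I = s'.I := by
    refine Ivl.Sep.eq (h₀.space s hs s' hs') ?_ (by linarith) (by linarith)
    have := Ivl.abs_center_sub_le_of_mem hx hx'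
    linarith
  exact hP.tile_ne s (hsub hs) s' (hsub hs') hne j ((TriTile.tile_eq_iff s s' j).2 ⟨hI, hω⟩)

/-- In a sparse class the first half of strong disjointness follows from the second. Intersecting
rectangles with equally long frequency intervals belong to one tri-tile, and those with different
lengths contradict the spatial condition at the common point. -/
theorem IsSparse.disjoint_rect {P₀ P : Finset TriTile} (h₀ : IsSparse P₀) (hsub : P₀ ⊆ P)
    (hP : IsRankOne P) {s s' t t' : TriTile} (hs : s ∈ P₀) (hs' : s' ∈ P₀) (hne : s ≠ s')
    {j : Fin 3} (ht : s.I.toSet ⊆ t.I.toSet) (ht' : s'.I.toSet ⊆ t'.I.toSet)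
    (h : (s.ω j).len < (s'.ω j).len → ((s.ω j).dil 2 ∩ (s'.ω j).dil 2).Nonempty →
      Disjoint s'.I.toSet t.I.toSet)
    (h' : (s'.ω j).len < (s.ω j).len → ((s'.ω j).dil 2 ∩ (s.ω j).dil 2).Nonempty →
      Disjoint s.I.toSet t'.I.toSet) :
    Disjoint (s.tile j).rect (s'.tile j).rect := by
  rw [Set.disjoint_left]
  rintro ⟨x, ξ⟩ ⟨hx, hξ⟩ ⟨hx', hξ'⟩
  simp only [TriTile.tile] at hx hξ hx' hξ'
  rcases lt_trichotomy (s.ω j).len (s'.ω j).len with hl | hl | hl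
  · exact Set.disjoint_left.1 (h hl ⟨ξ, Ivl.toSet_subset_dil_two _ hξ,
      Ivl.toSet_subset_dil_two _ hξ'⟩) hx' (ht hx)
  · have hpos := (s.ω j).len_pos
    have hc := Ivl.abs_center_sub_le_of_mem hξ hξ'
    have hω := Ivl.Sep.eq (h₀.freq s hs s' hs' j) (by linarith) (by linarith) (by linarith)
    exact hne (h₀.eq_of_mem hsub hP hs hs' hx hx' hω)
  · exact Set.disjoint_left.1 (h' hl ⟨ξ, Ivl.toSet_subset_dil_two _ hξ',
      Ivl.toSet_subset_dil_two _ hξ⟩) hx (ht' hx')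

/-- A finite family of positive numbers that pairwise differ by a factor at least two has a sum
comparable to its largest member. -/
theorem sum_le_two_mul_of_separated {ι : Type*} (F : Finset ι) (f : ι → ℝ) (hf : ∀ a ∈ F, 0 < f a)
    (hsep : ∀ a ∈ F, ∀ b ∈ F, a ≠ b → 2 * f a ≤ f b ∨ 2 * f b ≤ f a) {M : ℝ} (hM : 0 ≤ M)
    (hle : ∀ a ∈ F, f a ≤ M) : ∑ a ∈ F, f a ≤ 2 * M := by
  classical
  induction F using Finset.strongInduction generalizing M with
  | H F ih =>
    rcases F.eq_empty_or_nonempty with rfl | hF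
    · simpa using hM
    · obtain ⟨a, ha, hmax⟩ := F.exists_max_image f hF
      rw [← Finset.add_sum_erase F f ha]
      have hsub := Finset.erase_subset a F
      have := ih (F.erase a) (Finset.erase_ssubset ha) (fun b hb => hf b (hsub hb))
        (fun b hb c hc => hsep b (hsub hb) c (hsub hc)) (M := f a / 2) (by linarith [hf a ha])
        (fun b hb => by
          have hb' := hsub hb
          rcases hsep a ha b hb' (Finset.ne_of_mem_erase hb).symm with h | h
          · linarith [hmax b hb', hf b hb', hf a ha]
          · linarith)
      linarith [hle a ha]

/-! ### Splitting a grid into sparse classes -/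

/-- A finite symmetric relation of degree at most `d` has a proper colouring with `d + 1`
colours. -/
theorem exists_coloring {α : Type*} [DecidableEq α] (R : α → α → Prop) [DecidableRel R]
    (hR : ∀ a b, R a b → R b a) (d : ℕ) (F : Finset α)
    (hd : ∀ a ∈ F, (F.filter (R a)).card ≤ d) :
    ∃ col : α → Fin (d + 1), ∀ a ∈ F, ∀ b ∈ F, a ≠ b → R a b → col a ≠ col b := by
  induction F using Finset.induction_on with
  | empty => exact ⟨fun _ => 0, by simp⟩
  | insert a F ha ih =>
    obtain ⟨col, hcol⟩ := ih fun b hb => (Finset.card_le_card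
      (Finset.filter_subset_filter _ (Finset.subset_insert a F))).trans
        (hd b (Finset.mem_insert_of_mem hb))
    have hcard : ((F.filter (R a)).image col).card < Fintype.card (Fin (d + 1)) := by
      rw [Fintype.card_fin, Nat.lt_succ_iff]
      exact (Finset.card_image_le.trans (Finset.card_le_card
        (Finset.filter_subset_filter _ (Finset.subset_insert a F)))).trans
          (hd a (Finset.mem_insert_self a F))
    obtain ⟨c, hc⟩ : ∃ c, c ∉ (F.filter (R a)).image col := by
      by_contra! h
      rw [Finset.eq_univ_iff_forall.2 h, Finset.card_univ] at hcard
      exact lt_irrefl _ hcard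
    have key : ∀ b ∈ F, R a b → col b ≠ c := fun b hb hab h =>
      hc (Finset.mem_image.2 ⟨b, Finset.mem_filter.2 ⟨hb, hab⟩, h⟩)
    refine ⟨Function.update col a c, fun x hx y hy hxy hr => ?_⟩
    rcases Finset.mem_insert.1 hx with rfl | hx' <;> rcases Finset.mem_insert.1 hy with rfl | hy'
    · exact absurd rfl hxy
    · rw [Function.update_self, Function.update_of_ne hxy.symm]
      exact (key y hy' hr).symm
    · rw [Function.update_self, Function.update_of_ne hxy]
      exact key x hx' (hR _ _ hr)
    · have h₁ : x ≠ a := fun h => ha (h ▸ hx')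
      have h₂ : y ≠ a := fun h => ha (h ▸ hy')
      rw [Function.update_of_ne h₁, Function.update_of_ne h₂]
      exact hcol x hx' y hy' hxy hr

/-- The dyadic scale of an interval. -/
noncomputable def Ivl.scale (I : Ivl) : ℤ := Int.log 2 I.len

theorem Ivl.zpow_scale_le (I : Ivl) : (2 : ℝ) ^ I.scale ≤ I.len := by
  rw [scale]
  exact_mod_cast Int.zpow_log_le_self (b := 2) (by norm_num) I.len_pos

theorem Ivl.lt_zpow_scale (I : Ivl) : I.len < (2 : ℝ) ^ (I.scale + 1) := by
  rw [scale]
  exact_mod_cast Int.lt_zpow_succ_log_self (b := 2) (by norm_num) I.len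

/-- With r the dyadic scale of I, every J of the same scale close to I contains one of the 21 points
c(I) + m r, |m| ≤ 10, and the grid condition allows at most A such J per point. -/
theorem IsGrid.card_near_le {A : ℕ} {𝓘 : Set Ivl} (h : IsGrid A 𝓘) {F : Finset Ivl}
    (hF : (F : Set Ivl) ⊆ 𝓘) (I : Ivl) [DecidablePred fun J : Ivl =>
      J.scale = I.scale ∧ |I.center - J.center| < 2 * (I.len + J.len)] :
    (F.filter fun J => J.scale = I.scale ∧
      |I.center - J.center| < 2 * (I.len + J.len)).card ≤ 21 * A := by
  classical
  set r : ℝ := (2 : ℝ) ^ I.scale with hr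
  have hrpos : 0 < r := by positivity
  let X : ℤ → Finset Ivl := fun m => F.filter fun J =>
    (2 : ℝ) ^ (I.scale - 1) ≤ J.len ∧ J.len ≤ (2 : ℝ) ^ (I.scale + 1) ∧
      I.center + m * r ∈ J.toSet
  have hX : ∀ m, (X m).card ≤ A := by
    intro m
    have h₁ : ((X m : Finset Ivl) : Set Ivl) ⊆ {J ∈ 𝓘 | (2 : ℝ) ^ (I.scale - 1) ≤ J.len ∧
        J.len ≤ (2 : ℝ) ^ (I.scale + 1) ∧ I.center + m * r ∈ J.toSet} := by
      intro J hJ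
      rw [Finset.mem_coe, Finset.mem_filter] at hJ
      exact ⟨hF hJ.1, hJ.2⟩
    have h₂ := (Set.encard_le_encard h₁).trans (h I.scale (I.center + m * r))
    rw [Set.encard_coe_eq_coe_finsetCard] at h₂
    exact_mod_cast h₂
  have hsub : (F.filter fun J => J.scale = I.scale ∧
      |I.center - J.center| < 2 * (I.len + J.len)) ⊆ (Finset.Icc (-10 : ℤ) 10).biUnion X := by
    intro J hJ
    obtain ⟨hJF, hs, hc⟩ := Finset.mem_filter.1 hJ
    have hJ₁ := J.zpow_scale_le
    have hJ₂ := J.lt_zpow_scale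
    have hI₂ := I.lt_zpow_scale
    rw [hs, ← hr] at hJ₁
    rw [hs] at hJ₂
    have hr2 : (2 : ℝ) ^ (I.scale + 1) = 2 * r := by rw [zpow_add_one₀ two_ne_zero]; ring
    have hr1 : (2 : ℝ) ^ (I.scale - 1) = r / 2 := by rw [zpow_sub_one₀ two_ne_zero]; ring
    have hc' := abs_lt.1 hc
    have hlo := J.lo_eq
    have hhi := J.hi_eq
    -- This is the first point of c(I) + rℤ that is not to the left of J; it lies in J because |J| ≥
    -- r.
    set m : ℤ := ⌈(J.lo - I.center) / r⌉ with hm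
    have hm₁ : J.lo - I.center ≤ m * r := (div_le_iff₀ hrpos).1 (Int.le_ceil _)
    have hm₂ : (m : ℝ) * r < J.lo - I.center + r := by
      have : (m : ℝ) < (J.lo - I.center) / r + 1 := Int.ceil_lt_add_one _
      have h2 := mul_lt_mul_of_pos_right this hrpos
      rwa [add_mul, div_mul_cancel₀ _ hrpos.ne', one_mul] at h2
    rw [hr2] at hI₂ hJ₂
    refine Finset.mem_biUnion.2 ⟨m, Finset.mem_Icc.2 ⟨?_, ?_⟩, Finset.mem_filter.2
      ⟨hJF, by rw [hr1]; linarith, by rw [hr2]; linarith, by linarith, by linarith⟩⟩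
    · have : (-10 : ℝ) ≤ m := by
        by_contra hcon
        have := mul_lt_mul_of_pos_right (not_le.1 hcon) hrpos
        linarith
      exact_mod_cast this
    · have : (m : ℝ) ≤ 10 := by
        by_contra hcon
        have := mul_lt_mul_of_pos_right (not_le.1 hcon) hrpos
        linarith
      exact_mod_cast this
  calc _ ≤ _ := Finset.card_le_card hsub
    _ ≤ (Finset.Icc (-10 : ℤ) 10).card * A := Finset.card_biUnion_le_card_mul _ _ _ fun m _ => hX m
    _ = 21 * A := by simp

/-- The number of classes into which a grid is split. -/
def gridColors (A : ℕ) : Type := ZMod 40 × Fin (21 * A + 1)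

instance (A : ℕ) : Fintype (gridColors A) := inferInstanceAs (Fintype (ZMod 40 × Fin (21 * A + 1)))

/-- Scales that differ but agree modulo 40 are at least 40 apart, so the lengths differ by a factor
of at least 2^39 > 10^10. -/
theorem Ivl.sep_of_scale {I J : Ivl} (h : (I.scale : ZMod 40) = J.scale) (hlt : I.scale < J.scale) :
    10 ^ 10 * I.len ≤ J.len := by
  have h40 : ((40 : ℕ) : ℤ) ∣ J.scale - I.scale :=
    (ZMod.intCast_eq_intCast_iff_dvd_sub _ _ 40).1 h
  obtain ⟨c, hc⟩ := h40
  have hc1 : (0 : ℤ) < c := by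
    by_contra hcon
    push_cast at hc
    omega
  have hle : I.scale + 1 + 39 ≤ J.scale := by push_cast at hc; omega
  calc (10 : ℝ) ^ 10 * I.len ≤ 10 ^ 10 * 2 ^ (I.scale + 1) := by
        have := I.lt_zpow_scale
        gcongr
    _ ≤ 2 ^ (39 : ℤ) * 2 ^ (I.scale + 1) := by
        gcongr
        norm_num
    _ = 2 ^ (I.scale + 1 + 39) := by
        rw [← zpow_add₀ two_ne_zero, add_comm]
    _ ≤ 2 ^ J.scale := zpow_le_zpow_right₀ (by norm_num) hle
    _ ≤ J.len := J.zpow_scale_le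

/-- The residue of the scale separates intervals of different scales, and a proper coloring of the
proximity relation separates those of the same scale. -/
theorem IsGrid.exists_coloring {A : ℕ} {𝓘 : Set Ivl} (h : IsGrid A 𝓘) (F : Finset Ivl)
    (hF : (F : Set Ivl) ⊆ 𝓘) :
    ∃ col : Ivl → gridColors A, ∀ I ∈ F, ∀ J ∈ F, col I = col J → I = J ∨ I.Sep J := by
  classical
  obtain ⟨col, hcol⟩ := BilinearSquare.exists_coloring
    (fun I J : Ivl => J.scale = I.scale ∧ |I.center - J.center| < 2 * (I.len + J.len))
    (fun I J h => ⟨h.1.symm, by rw [abs_sub_comm, add_comm J.len]; exact h.2⟩) (21 * A) F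
    (fun I _ => h.card_near_le hF I)
  refine ⟨fun I => ((I.scale : ZMod 40), col I), fun I hI J hJ hIJ => ?_⟩
  obtain ⟨h₁, h₂⟩ := Prod.ext_iff.1 hIJ
  by_cases hne : I = J
  · exact Or.inl hne
  · right
    rcases lt_trichotomy I.scale J.scale with hs | hs | hs
    · exact Or.inl (Ivl.sep_of_scale h₁ hs)
    · right; right
      by_contra hc
      exact hcol I hI J hJ hne ⟨hs.symm, not_le.1 hc⟩ h₂
    · exact Or.inr (Or.inl (Ivl.sep_of_scale h₁.symm hs))

/-- The number of sparse classes into which a collection is split. -/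
def numClasses (A : ℕ) : ℕ := Fintype.card (gridColors A × (Fin 3 → gridColors A))

/-- If a sum over each sparse subcollection of a collection is at most `M`, then the whole sum is
at most the number of classes times `M`. -/
theorem sum_le_of_sparse {A : ℕ} {P : Finset TriTile}
    (hI : IsGrid A {I | ∃ s ∈ P, I = s.I}) (hω : IsGrid A {w | ∃ s ∈ P, ∃ j, w = s.ω j})
    (F : TriTile → ℝ) (M : ℝ) (h : ∀ P₀ ⊆ P, IsSparse P₀ → ∑ s ∈ P₀, F s ≤ M) :
    ∑ s ∈ P, F s ≤ numClasses A * M := by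
  classical
  obtain ⟨c, hc⟩ := hI.exists_coloring (P.image TriTile.I) (by
    intro I hI
    obtain ⟨s, hs, rfl⟩ := Finset.mem_image.1 (Finset.mem_coe.1 hI)
    exact ⟨s, hs, rfl⟩)
  obtain ⟨d, hd⟩ := hω.exists_coloring ((P ×ˢ Finset.univ).image fun p => p.1.ω p.2) (by
    intro I hI
    obtain ⟨⟨s, j⟩, hs, rfl⟩ := Finset.mem_image.1 (Finset.mem_coe.1 hI)
    exact ⟨s, (Finset.mem_product.1 hs).1, j, rfl⟩)
  let g : TriTile → gridColors A × (Fin 3 → gridColors A) := fun s => (c s.I, fun j => d (s.ω j))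
  rw [← Finset.sum_fiberwise P g F, numClasses]
  refine (Finset.sum_le_card_nsmul _ _ M fun x _ => h _ (Finset.filter_subset _ _) ?_).trans_eq
    (by rw [nsmul_eq_mul, Finset.card_univ])
  have key : ∀ s ∈ P.filter (fun s => g s = x), ∀ s' ∈ P.filter (fun s => g s = x),
      s ∈ P ∧ s' ∈ P ∧ g s = g s' := fun s hs s' hs' =>
    ⟨(Finset.mem_filter.1 hs).1, (Finset.mem_filter.1 hs').1,
      (Finset.mem_filter.1 hs).2.trans (Finset.mem_filter.1 hs').2.symm⟩
  refine ⟨fun s hs s' hs' => ?_, fun s hs s' hs' j => ?_⟩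
  · obtain ⟨h₁, h₂, h₃⟩ := key s hs s' hs'
    exact hc _ (Finset.mem_image_of_mem _ h₁) _ (Finset.mem_image_of_mem _ h₂)
      (Prod.ext_iff.1 h₃).1
  · obtain ⟨h₁, h₂, h₃⟩ := key s hs s' hs'
    exact hd _ (Finset.mem_image.2 ⟨(s, j), by simp [h₁], rfl⟩) _
      (Finset.mem_image.2 ⟨(s', j), by simp [h₂], rfl⟩) (congrFun (Prod.ext_iff.1 h₃).2 j)

/-! ### Trees and coverings by trees -/

/-- `T` is a `k`-tree of `P` with top `t`, where `P` lies in a single strip. -/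
structure IsKTree (P : Finset TriTile) (k : Fin 3) (t : TriTile) (T : Finset TriTile) : Prop where
  top_mem : t ∈ P
  subset : T ⊆ P
  belowEq : ∀ s ∈ T, (s.tile k).BelowEq (t.tile k)

theorem IsKTree.mono {P : Finset TriTile} {k : Fin 3} {t : TriTile} {T T' : Finset TriTile}
    (h : IsKTree P k t T) (hT : T' ⊆ T) : IsKTree P k t T' :=
  ⟨h.top_mem, hT.trans h.subset, fun s hs => h.belowEq s (hT hs)⟩

theorem isKTree_singleton {P : Finset TriTile} {s : TriTile} (hs : s ∈ P) (k : Fin 3) :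
    IsKTree P k s {s} :=
  ⟨hs, Finset.singleton_subset_iff.2 hs, fun s' hs' => by
    rw [Finset.mem_singleton.1 hs']
    exact s.belowEq_refl k⟩

/-- `X` behaves like a union of trees of `P` whose tops have total length at most `M`: sums over
`X` are controlled by sums over trees. -/
def CoverBound (P X : Finset TriTile) (M : ℝ) : Prop :=
  ∀ (β : ℝ) (F : TriTile → ℝ), 0 ≤ β → (∀ s, 0 ≤ F s) →
    (∀ k t T, IsKTree P k t T → ∑ s ∈ T, F s ≤ β * t.I.len) → ∑ s ∈ X, F s ≤ β * M

theorem CoverBound.mono {P X Y : Finset TriTile} {M N : ℝ} (h : CoverBound P Y M) (hXY : X ⊆ Y)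
    (hMN : M ≤ N) : CoverBound P X N := fun β F hβ hF hT =>
  (Finset.sum_le_sum_of_subset_of_nonneg hXY fun s _ _ => hF s).trans
    ((h β F hβ hF hT).trans (mul_le_mul_of_nonneg_left hMN hβ))

theorem CoverBound.of_subset_biUnion [DecidableEq TriTile] {ι : Type*} {P X : Finset TriTile}
    {D : Finset ι} {Y : ι → Finset TriTile} {M : ι → ℝ} (h : ∀ i ∈ D, CoverBound P (Y i) (M i))
    (hX : X ⊆ D.biUnion Y) : CoverBound P X (∑ i ∈ D, M i) := by
  intro β F hβ hF hT
  calc ∑ s ∈ X, F s ≤ ∑ s ∈ D.biUnion Y, F s :=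
        Finset.sum_le_sum_of_subset_of_nonneg hX fun s _ _ => hF s
    _ ≤ ∑ i ∈ D, ∑ s ∈ Y i, F s := by
        classical
        clear hX h
        induction D using Finset.induction_on with
        | empty => simp
        | insert a D ha ih =>
          rw [Finset.biUnion_insert, Finset.sum_insert ha]
          have h₁ := Finset.sum_union_inter (s₁ := Y a) (s₂ := D.biUnion Y) (f := F)
          have h₂ := Finset.sum_nonneg fun s (_ : s ∈ Y a ∩ D.biUnion Y) => hF s
          linarith
    _ ≤ ∑ i ∈ D, β * M i := Finset.sum_le_sum fun i hi => h i hi β F hβ hF hT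
    _ = β * ∑ i ∈ D, M i := (Finset.mul_sum _ _ _).symm

theorem CoverBound.of_subset_union [DecidableEq TriTile] {P X Y Z : Finset TriTile} {M N : ℝ}
    (hY : CoverBound P Y M) (hZ : CoverBound P Z N) (hX : X ⊆ Y ∪ Z) :
    CoverBound P X (M + N) := by
  intro β F hβ hF hT
  have h₁ := Finset.sum_le_sum_of_subset_of_nonneg hX fun s _ _ => hF s
  have h₂ := Finset.sum_union_inter (s₁ := Y) (s₂ := Z) (f := F)
  have h₃ := Finset.sum_nonneg fun s (_ : s ∈ Y ∩ Z) => hF s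
  linarith [hY β F hβ hF hT, hZ β F hβ hF hT]

theorem IsKTree.coverBound {P : Finset TriTile} {k : Fin 3} {t : TriTile} {T : Finset TriTile}
    (h : IsKTree P k t T) : CoverBound P T t.I.len := fun _ _ _ _ hT => hT _ _ _ h

/-- The tri-tiles much shorter than `t` that meet `t` in space and lie above it in frequency. -/
noncomputable def nearSet (P₀ : Finset TriTile) (j : Fin 3) (t : TriTile) : Finset TriTile :=
  open Classical in
  P₀.filter fun s => 10 ^ 10 * s.I.len ≤ t.I.len ∧ ¬ Disjoint s.I.toSet t.I.toSet ∧
    |(t.ω j).center - (s.ω j).center| ≤ 3 / 2 * ((s.ω j).len - (t.ω j).len)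

/-- Each tri-tile is a tree by itself, so only the lengths must be summed. The frequency intervals
all lie close to that of t, so sparseness makes two of them equal or of very different length.
Equality is excluded by the common point x, and the lengths then sum geometrically. -/
theorem sum_le_of_mem {P₀ P : Finset TriTile} (h₀ : IsSparse P₀) (hsub : P₀ ⊆ P)
    (hP : IsRankOne P) (j : Fin 3) (x : ℝ) {t : TriTile} {X : Finset TriTile} (hX : X ⊆ P₀)
    (h : ∀ s ∈ X, x ∈ s.I.toSet ∧ s.I.len ≤ t.I.len ∧
      |(t.ω j).center - (s.ω j).center| ≤ 3 / 2 * ((s.ω j).len - (t.ω j).len)) :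
    CoverBound P X (2 * t.I.len) := by
  intro β F hβ hF hT
  calc ∑ s ∈ X, F s ≤ ∑ s ∈ X, β * s.I.len := Finset.sum_le_sum fun s hs => by
        simpa using hT j s {s} (isKTree_singleton (hsub (hX hs)) j)
    _ = β * ∑ s ∈ X, s.I.len := (Finset.mul_sum _ _ _).symm
    _ ≤ β * (2 * t.I.len) := by
        refine mul_le_mul_of_nonneg_left ?_ hβ
        refine sum_le_two_mul_of_separated X (fun s => s.I.len) (fun s _ => s.I.len_pos)
          (fun a ha b hb hab => ?_) t.I.len_pos.le (fun s hs => (h s hs).2.1)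
        obtain ⟨hax, -, hac⟩ := h a ha
        obtain ⟨hbx, -, hbc⟩ := h b hb
        have hc : |(a.ω j).center - (b.ω j).center| < 2 * ((a.ω j).len + (b.ω j).len) := by
          have h₁ := abs_sub_le (a.ω j).center (t.ω j).center (b.ω j).center
          rw [abs_sub_comm (a.ω j).center (t.ω j).center] at h₁
          have := (a.ω j).len_pos
          have := (b.ω j).len_pos
          have := (t.ω j).len_pos
          linarith
        have ha₀ := a.I.len_pos
        have hb₀ := b.I.len_pos
        rcases h₀.freq a (hX ha) b (hX hb) j with hω | hω
        · exact absurd (h₀.eq_of_mem hsub hP (hX ha) (hX hb) hax hbx hω) hab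
        · rcases hω.len_le_or hc with hω | hω
          · right
            have := (TriTile.mul_len_le_iff _ _ _ _ _).1 hω
            linarith
          · left
            have := (TriTile.mul_len_le_iff _ _ _ _ _).1 hω
            linarith

/-- Tri-tiles contained in I_t form a j-tree with top t. The space intervals are not nested, so the
others must be treated separately: they contain an endpoint of I_t and cost 2 |I_t| for each
endpoint. -/
theorem coverBound_nearSet {P₀ P : Finset TriTile} (h₀ : IsSparse P₀) (hsub : P₀ ⊆ P)
    (hP : IsRankOne P) (j : Fin 3) {t : TriTile} (ht : t ∈ P) :
    CoverBound P (nearSet P₀ j t) (5 * t.I.len) := by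
  classical
  set Y := nearSet P₀ j t with hY
  have hmem : ∀ s ∈ Y, s ∈ P₀ ∧ 10 ^ 10 * s.I.len ≤ t.I.len ∧ ¬ Disjoint s.I.toSet t.I.toSet ∧
    |(t.ω j).center - (s.ω j).center| ≤ 3 / 2 * ((s.ω j).len - (t.ω j).len) := fun s hs =>
      Finset.mem_filter.1 hs
  have h₁ : IsKTree P j t (Y.filter fun s => s.I.toSet ⊆ t.I.toSet) := by
    refine ⟨ht, fun s hs => hsub (hmem s (Finset.mem_filter.1 hs).1).1, fun s hs => ?_⟩
    obtain ⟨hs, hst⟩ := Finset.mem_filter.1 hs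
    obtain ⟨-, hl, -, hc⟩ := hmem s hs
    exact TriTile.belowEq_of_subset hst (by linarith [s.I.len_pos]) hc
  have h₂ : ∀ x, CoverBound P (Y.filter fun s => x ∈ s.I.toSet) (2 * t.I.len) := fun x =>
    sum_le_of_mem h₀ hsub hP j x
      (fun s hs => (hmem s (Finset.mem_filter.1 hs).1).1) fun s hs => by
        obtain ⟨hs, hx⟩ := Finset.mem_filter.1 hs
        obtain ⟨-, hl, -, hc⟩ := hmem s hs
        exact ⟨hx, by linarith [s.I.len_pos], hc⟩
  have h₃ := (h₂ t.I.lo).of_subset_union (h₂ t.I.hi) subset_rfl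
  refine (h₁.coverBound.of_subset_union h₃ (X := Y) fun s hs => ?_).mono subset_rfl (by linarith)
  simp only [Finset.mem_union, Finset.mem_filter, hs, true_and]
  exact Ivl.subset_or_mem_of_not_disjoint (hmem s hs).2.2.1

/-! ### Selection of strongly disjoint trees -/

/-- The density of the tree is maximal among its own subtrees. -/
def IsDensest (P : Finset TriTile) (k : Fin 3) (m : Finset TriTile → ℝ)
    (p : TriTile × Finset TriTile) : Prop :=
  ∀ t' T', T' ⊆ p.2 → IsKTree P k t' T' → m T' / t'.I.len ≤ m p.2 / p.1.I.len

/-- Passing to a densest subtree supplies the upper bound on subtrees that is demanded in the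
definition of the energy. -/
theorem exists_isDensest {P : Finset TriTile} {k : Fin 3} (m : Finset TriTile → ℝ) {t : TriTile}
    {T : Finset TriTile} (h : IsKTree P k t T) :
    ∃ p : TriTile × Finset TriTile, IsKTree P k p.1 p.2 ∧ p.2 ⊆ T ∧ IsDensest P k m p ∧
      m T / t.I.len ≤ m p.2 / p.1.I.len := by
  classical
  let X := (P ×ˢ T.powerset).filter fun p => IsKTree P k p.1 p.2
  have hX : ∀ p, p ∈ X ↔ p.2 ⊆ T ∧ IsKTree P k p.1 p.2 := fun p => by
    simp only [X, Finset.mem_filter, Finset.mem_product, Finset.mem_powerset]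
    exact ⟨fun hp => ⟨hp.1.2, hp.2⟩, fun hp => ⟨⟨hp.2.top_mem, hp.1⟩, hp.2⟩⟩
  obtain ⟨p, hp, hmax⟩ := X.exists_max_image (fun p => m p.2 / p.1.I.len)
    ⟨(t, T), (hX _).2 ⟨subset_rfl, h⟩⟩
  obtain ⟨hpT, hpt⟩ := (hX p).1 hp
  exact ⟨p, hpt, hpT, fun t' T' hT' ht' => hmax (t', T') ((hX _).2 ⟨hT'.trans hpT, ht'⟩),
    hmax (t, T) ((hX _).2 ⟨subset_rfl, h⟩)⟩

/-- Whatever could violate strong disjointness with an already selected tree lies in the near set of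
its top. Sparseness makes ω_{s'} at least 10^10 times longer than ω_s, whereas rank one puts the
center of ω_t within 10^7/2 lengths of ω_s. At the scale of ω_{s'} the two are indistinguishable. -/
theorem subset_nearSet_of_freq {P₀ P : Finset TriTile} (h₀ : IsSparse P₀) (hsub : P₀ ⊆ P)
    (hP : IsRankOne P) {j k : Fin 3} {t s s' : TriTile} (ht : t ∈ P)
    (hs : s ∈ P₀) (hs' : s' ∈ P₀) (hst : (s.tile k).BelowEq (t.tile k))
    (hl : (s.ω j).len < (s'.ω j).len) (hd : ((s.ω j).dil 2 ∩ (s'.ω j).dil 2).Nonempty)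
    (hI : ¬ Disjoint s'.I.toSet t.I.toSet) : s' ∈ nearSet P₀ j t := by
  classical
  have hc := Ivl.abs_center_sub_le_of_dil hd
  have p₁ := (s.ω j).len_pos
  have p₂ := (s'.ω j).len_pos
  have hsep := Ivl.Sep.len_le (h₀.freq s hs s' hs' j) (by linarith) hl
  have hlen := (TriTile.mul_len_le_iff _ _ _ _ _).1 hsep
  have hle := Ivl.len_le_of_subset (TriTile.subset_of_belowEq hst)
  have hω : 1 * (t.ω j).len ≤ (s.ω j).len := (TriTile.mul_len_le_iff _ _ _ _ _).2 (by linarith)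
  have hn := hP.abs_center_le (hsub hs) ht hst j
  have htri := abs_sub_le (t.ω j).center (s.ω j).center (s'.ω j).center
  have p₃ := (t.ω j).len_pos
  exact Finset.mem_filter.2 ⟨hs', by linarith, hI, by linarith⟩

/-- The greedy selection of trees: among the candidates one with the largest key is chosen, a
densest subtree of it is selected and is removed together with everything that could violate
strong disjointness. -/
theorem exists_selection [DecidableEq TriTile] {P₀ P : Finset TriTile} (h₀ : IsSparse P₀)
    (hsub : P₀ ⊆ P) (hP : IsRankOne P) (j k : Fin 3) {m : Finset TriTile → ℝ} (hm : m ∅ = 0)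
    {τ : ℝ} (hτ : 0 < τ) (Cand : TriTile → Finset TriTile → Prop) (key : TriTile → ℝ)
    (htree : ∀ t T, Cand t T → IsKTree P k t T ∧ τ * t.I.len < m T)
    (hkey : ∀ t T t' T', Cand t T → Cand t' T' → T ⊆ P₀ → T' ⊆ P₀ → ∀ s ∈ T, ∀ s' ∈ T',
      (s.ω j).len < (s'.ω j).len → ((s.ω j).dil 2 ∩ (s'.ω j).dil 2).Nonempty → key t' < key t)
    (P' : Finset TriTile) (hP' : P' ⊆ P₀) :
    ∃ (D : Finset (TriTile × Finset TriTile)) (P'' : Finset TriTile), P'' ⊆ P' ∧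
      (∀ p ∈ D, IsKTree P k p.1 p.2 ∧ τ ≤ m p.2 / p.1.I.len ∧ IsDensest P k m p ∧ p.2 ⊆ P' ∧
        ∃ t T, Cand t T ∧ T ⊆ P' ∧ p.2 ⊆ T) ∧
      StronglyDisjoint j D ∧ (∀ t T, T ⊆ P'' → ¬ Cand t T) ∧
      P' \ P'' ⊆ D.biUnion fun p => p.2 ∪ nearSet P₀ j p.1 := by
  classical
  induction P' using Finset.strongInduction with
  | H P' ih =>
    by_cases hC : ∃ t T, T ⊆ P' ∧ Cand t T
    swap
    · refine ⟨∅, P', subset_rfl, by simp, ?_, fun t T hT hc => hC ⟨t, T, hT, hc⟩, by simp⟩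
      intro p hp
      simp at hp
    let tops := P.filter fun t => ∃ T, T ⊆ P' ∧ Cand t T
    have htops : tops.Nonempty := by
      obtain ⟨t, T, hT, hc⟩ := hC
      exact ⟨t, Finset.mem_filter.2 ⟨(htree t T hc).1.top_mem, T, hT, hc⟩⟩
    obtain ⟨t, ht, hmax⟩ := tops.exists_max_image key htops
    obtain ⟨htP, T, hTP', hcand⟩ := Finset.mem_filter.1 ht
    obtain ⟨hkt, hτT⟩ := htree t T hcand
    obtain ⟨p, hp, hpT, hpd, hpm⟩ := exists_isDensest m hkt
    have hτp : τ ≤ m p.2 / p.1.I.len :=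
      ((lt_div_iff₀ t.I.len_pos).2 hτT).le.trans hpm
    -- The selected tree has positive mass, hence is non-empty, and its removal makes the induction
    -- advance.
    have hpne : p.2.Nonempty := by
      by_contra hne
      rw [Finset.not_nonempty_iff_eq_empty.1 hne, hm, zero_div] at hτp
      linarith
    have hpP' := hpT.trans hTP'
    set N := p.2 ∪ nearSet P₀ j p.1 with hN
    have hssub : P' \ N ⊂ P' := by
      refine ⟨Finset.sdiff_subset, fun hcon => ?_⟩
      obtain ⟨s, hs⟩ := hpne
      exact (Finset.mem_sdiff.1 (hcon (hpP' hs))).2 (Finset.mem_union_left _ hs)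
    obtain ⟨D, P'', hP'', hD, hdisj, hno, hcov⟩ := ih (P' \ N) hssub (hssub.subset.trans hP')
    refine ⟨insert p D, P'', hP''.trans hssub.subset, ?_, ?_, hno, ?_⟩
    · intro q hq
      rcases Finset.mem_insert.1 hq with rfl | hq
      · exact ⟨hp, hτp, hpd, hpP', t, T, hcand, hTP', hpT⟩
      · obtain ⟨h₁, h₂, h₃, h₄, u, U, h₅, h₆, h₇⟩ := hD q hq
        exact ⟨h₁, h₂, h₃, h₄.trans hssub.subset, u, U, h₅, h₆.trans hssub.subset, h₇⟩
    · have hfst : ∀ q ∈ D, ∀ s ∈ p.2, ∀ s' ∈ q.2, (s.ω j).len < (s'.ω j).len →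
          ((s.ω j).dil 2 ∩ (s'.ω j).dil 2).Nonempty → Disjoint s'.I.toSet p.1.I.toSet := by
        intro q hq s hs s' hs' hl hd
        -- Otherwise s' lies in the near set of the new top, which was removed before q was
        -- selected.
        by_contra hI
        have hs'N := (Finset.mem_sdiff.1 ((hD q hq).2.2.2.1 hs')).2
        have hs'P := (Finset.mem_sdiff.1 ((hD q hq).2.2.2.1 hs')).1
        exact hs'N (Finset.mem_union_right _ (subset_nearSet_of_freq h₀ hsub hP hp.top_mem
          (hP' (hpP' hs)) (hP' hs'P) (hp.belowEq s hs) hl hd hI))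
      have hsnd : ∀ q ∈ D, ∀ s ∈ p.2, ∀ s' ∈ q.2, (s'.ω j).len < (s.ω j).len →
          ((s'.ω j).dil 2 ∩ (s.ω j).dil 2).Nonempty → Disjoint s.I.toSet q.1.I.toSet := by
        intro q hq s hs s' hs' hl hd
        obtain ⟨-, -, -, -, u, U, hu, hU, hqU⟩ := hD q hq
        have hU' := hU.trans hssub.subset
        -- The candidate from which q was cut was already available when T was chosen. The
        -- configuration would give it a larger key, so it never occurs. The keys compare the tops
        -- of candidates, not those of densest subtrees.
        have h₁ := hkey u U t T hu hcand (hU'.trans hP') (hTP'.trans hP') s' (hqU hs') s (hpT hs)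
          hl hd
        have h₂ := hmax u (Finset.mem_filter.2 ⟨(htree u U hu).1.top_mem, U, hU', hu⟩)
        linarith
      have hrect : ∀ q ∈ D, ∀ s ∈ p.2, ∀ s' ∈ q.2,
          Disjoint (s.tile j).rect (s'.tile j).rect := by
        intro q hq s hs s' hs'
        have hs'P := Finset.mem_sdiff.1 ((hD q hq).2.2.2.1 hs')
        refine h₀.disjoint_rect hsub hP (hP' (hpP' hs)) (hP' hs'P.1) ?_
          (TriTile.subset_of_belowEq (hp.belowEq s hs))
          (TriTile.subset_of_belowEq ((hD q hq).1.belowEq s' hs'))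
          (hfst q hq s hs s' hs') (hsnd q hq s hs s' hs')
        rintro rfl
        exact hs'P.2 (Finset.mem_union_left _ hs)
      intro q hq q' hq' hne s hs s' hs'
      rcases Finset.mem_insert.1 hq with rfl | hq₁ <;> rcases Finset.mem_insert.1 hq' with rfl | hq₂
      · exact absurd rfl hne
      · exact ⟨hrect q' hq₂ s hs s' hs', hfst q' hq₂ s hs s' hs'⟩
      · exact ⟨(hrect q hq₁ s' hs' s hs).symm, hsnd q hq₁ s' hs' s hs⟩
      · exact hdisj q hq₁ q' hq₂ hne s hs s' hs'
    · rw [Finset.biUnion_insert]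
      intro s hs
      obtain ⟨hs₁, hs₂⟩ := Finset.mem_sdiff.1 hs
      by_cases hsN : s ∈ N
      · exact Finset.mem_union_left _ hsN
      · exact Finset.mem_union_right _ (hcov (Finset.mem_sdiff.2
          ⟨Finset.mem_sdiff.2 ⟨hs₁, hsN⟩, hs₂⟩))

/-! ### Energies and the decomposition into trees -/

/-- The square of the energy of `P` with respect to strongly `j`-disjoint families of `k`-trees is
at most `e`. -/
def EnergyBound (P : Finset TriTile) (j k : Fin 3) (m : Finset TriTile → ℝ) (e : ℝ) : Prop :=
  ∀ (r : ℤ) (D : Finset (TriTile × Finset TriTile)), (∀ p ∈ D, IsKTree P k p.1 p.2) →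
    StronglyDisjoint j D → (∀ p ∈ D, (4 : ℝ) ^ r * p.1.I.len ≤ m p.2) →
    (∀ p ∈ D, ∀ t' T', T' ⊆ p.2 → IsKTree P k t' T' → m T' ≤ (4 : ℝ) ^ (r + 1) * t'.I.len) →
    (4 : ℝ) ^ r * ∑ p ∈ D, p.1.I.len ≤ e

theorem StronglyDisjoint.mono {j : Fin 3} {D D' : Finset (TriTile × Finset TriTile)}
    (h : StronglyDisjoint j D) (hD : D' ⊆ D) : StronglyDisjoint j D' :=
  fun p hp p' hp' => h p (hD hp) p' (hD hp')

theorem EnergyBound.nonneg {P : Finset TriTile} {j k : Fin 3} {m : Finset TriTile → ℝ} {e : ℝ}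
    (h : EnergyBound P j k m e) : 0 ≤ e := by
  simpa using h 0 ∅ (by simp) (fun p hp => by simp at hp) (by simp) (by simp)

/-- Sort the trees by the power 4^r next below their density. Being densest, the trees of one level
form a family admissible for the energy, so their tops have total length at most e 4^{-r}. Only
levels with 4^{-r} ≤ 4/τ occur, and the geometric sum over r costs a factor 2. -/
theorem EnergyBound.sum_len_le {P : Finset TriTile} {j k : Fin 3} {m : Finset TriTile → ℝ} {e : ℝ}
    (h : EnergyBound P j k m e) {D : Finset (TriTile × Finset TriTile)} {τ : ℝ} (hτ : 0 < τ)
    (hD : ∀ p ∈ D, IsKTree P k p.1 p.2 ∧ τ ≤ m p.2 / p.1.I.len ∧ IsDensest P k m p)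
    (hdisj : StronglyDisjoint j D) : ∑ p ∈ D, p.1.I.len ≤ 8 * e / τ := by
  classical
  have hr : ∀ p : TriTile × Finset TriTile, ∃ r : ℤ, p ∈ D →
      (4 : ℝ) ^ r ≤ m p.2 / p.1.I.len ∧ m p.2 / p.1.I.len < (4 : ℝ) ^ (r + 1) := by
    intro p
    by_cases hp : p ∈ D
    · obtain ⟨r, hr⟩ := exists_mem_Ico_zpow (hτ.trans_le (hD p hp).2.1)
        (by norm_num : (1 : ℝ) < 4)
      exact ⟨r, fun _ => hr⟩
    · exact ⟨0, fun h => absurd h hp⟩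
  choose r hr using hr
  rw [← Finset.sum_fiberwise_of_maps_to (t := D.image r) fun p hp => Finset.mem_image_of_mem r hp]
  have hfib : ∀ n ∈ D.image r, ∑ p ∈ D with r p = n, p.1.I.len ≤ e * (4 : ℝ) ^ (-n) := by
    intro n _
    have hmem : ∀ p ∈ D.filter (fun p => r p = n), p ∈ D ∧ r p = n := fun p hp =>
      Finset.mem_filter.1 hp
    have := h n (D.filter fun p => r p = n) (fun p hp => (hD p (hmem p hp).1).1)
      (hdisj.mono (Finset.filter_subset _ _))
      (fun p hp => by
        obtain ⟨hp', rfl⟩ := hmem p hp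
        exact (le_div_iff₀ p.1.I.len_pos).1 (hr p hp').1)
      (fun p hp t' T' hT' ht' => by
        obtain ⟨hp', rfl⟩ := hmem p hp
        exact (div_le_iff₀ t'.I.len_pos).1
          (((hD p hp').2.2 t' T' hT' ht').trans (hr p hp').2.le))
    rw [zpow_neg, ← div_eq_mul_inv, le_div_iff₀ (by positivity), mul_comm]
    exact this
  have hsum : ∑ n ∈ D.image r, (4 : ℝ) ^ (-n) ≤ 2 * (4 / τ) := by
    have hlt : ∀ a b : ℤ, a < b → 2 * (4 : ℝ) ^ (-b) ≤ 4 ^ (-a) := by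
      intro a b hab
      have h₁ : (4 : ℝ) ^ (-b + 1) ≤ 4 ^ (-a) := zpow_le_zpow_right₀ (by norm_num) (by omega)
      rw [zpow_add_one₀ (by norm_num)] at h₁
      have : (0 : ℝ) < 4 ^ (-b) := by positivity
      linarith
    refine sum_le_two_mul_of_separated _ _ (fun n _ => by positivity) (fun a _ b _ hab => ?_)
      (by positivity) (fun n hn => ?_)
    · rcases lt_or_gt_of_ne hab with h | h
      · exact Or.inr (hlt a b h)
      · exact Or.inl (hlt b a h)
    · obtain ⟨p, hp, rfl⟩ := Finset.mem_image.1 hn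
      have h₁ := (hD p hp).2.1.trans (hr p hp).2.le
      rw [zpow_add_one₀ (by norm_num)] at h₁
      rw [zpow_neg, inv_eq_one_div, div_le_div_iff₀ (by positivity) hτ]
      linarith
  calc _ ≤ ∑ n ∈ D.image r, e * (4 : ℝ) ^ (-n) := Finset.sum_le_sum hfib
    _ = e * ∑ n ∈ D.image r, (4 : ℝ) ^ (-n) := (Finset.mul_sum _ _ _).symm
    _ ≤ e * (2 * (4 / τ)) := mul_le_mul_of_nonneg_left hsum h.nonneg
    _ = 8 * e / τ := by ring

/-- Here G is what the greedy selection leaves. The removed part is covered by the selected trees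
and their near sets, at cost 1 + 5 = 6 times the total length 8 e / τ of the tops. -/
theorem exists_subset_of_cand {P₀ P : Finset TriTile} (h₀ : IsSparse P₀)
    (hsub : P₀ ⊆ P) (hP : IsRankOne P) {j k : Fin 3} {m : Finset TriTile → ℝ} (hm : m ∅ = 0)
    {e : ℝ} (hE : EnergyBound P j k m e) {τ : ℝ} (hτ : 0 < τ)
    (Cand : TriTile → Finset TriTile → Prop) (key : TriTile → ℝ)
    (htree : ∀ t T, Cand t T → IsKTree P k t T ∧ τ * t.I.len < m T)
    (hkey : ∀ t T t' T', Cand t T → Cand t' T' → T ⊆ P₀ → T' ⊆ P₀ → ∀ s ∈ T, ∀ s' ∈ T',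
      (s.ω j).len < (s'.ω j).len → ((s.ω j).dil 2 ∩ (s'.ω j).dil 2).Nonempty → key t' < key t) :
    ∃ G ⊆ P₀, (∀ t T, T ⊆ G → ¬ Cand t T) ∧
      ∀ X ⊆ P₀, Disjoint X G → CoverBound P X (48 * e / τ) := by
  classical
  obtain ⟨D, G, hG, hD, hdisj, hno, hcov⟩ := exists_selection h₀ hsub hP j k hm hτ Cand key htree
    hkey P₀ subset_rfl
  refine ⟨G, hG, hno, fun X hX hXG => ?_⟩
  have hlen := hE.sum_len_le hτ (fun p hp => ⟨(hD p hp).1, (hD p hp).2.1, (hD p hp).2.2.1⟩) hdisj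
  have hX' : X ⊆ D.biUnion fun p => p.2 ∪ nearSet P₀ j p.1 := fun s hs => hcov
    (Finset.mem_sdiff.2 ⟨hX hs, Finset.disjoint_left.1 hXG hs⟩)
  refine CoverBound.mono (CoverBound.of_subset_biUnion (M := fun p => p.1.I.len + 5 * p.1.I.len)
    (fun p hp => (hD p hp).1.coverBound.of_subset_union
      (coverBound_nearSet h₀ hsub hP j (hD p hp).1.top_mem) subset_rfl) hX') subset_rfl ?_
  rw [← Finset.sum_add_distrib.symm, ← Finset.mul_sum]
  have : 48 * e / τ = 6 * (8 * e / τ) := by ring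
  linarith

theorem sum_len_le_of_disjoint {X : Finset TriTile} {J : Ivl}
    (h : ∀ s ∈ X, s.I.toSet ⊆ J.toSet)
    (hd : ∀ s ∈ X, ∀ s' ∈ X, s ≠ s' → Disjoint s.I.toSet s'.I.toSet) :
    ∑ s ∈ X, s.I.len ≤ J.len := by
  have hvol : ∀ I : Ivl, MeasureTheory.volume I.toSet = ENNReal.ofReal I.len := fun I =>
    Real.volume_Ico
  have h₁ := MeasureTheory.measure_biUnion_finset (μ := MeasureTheory.volume) (s := X)
    (f := fun s => s.I.toSet) (fun s hs s' hs' hne => hd s hs s' hs' hne)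
    (fun s _ => measurableSet_Ico)
  have h₂ := MeasureTheory.measure_mono (μ := MeasureTheory.volume)
    (Set.iUnion₂_subset h : (⋃ s ∈ X, s.I.toSet) ⊆ J.toSet)
  rw [h₁, hvol] at h₂
  simp only [hvol] at h₂
  rw [← ENNReal.ofReal_sum_of_nonneg fun s _ => s.I.len_pos.le] at h₂
  exact (ENNReal.ofReal_le_ofReal_iff J.len_pos.le).1 h₂

/-- Lacunarity says nothing about tri-tiles almost as long as the top. Their lengths are comparable
and their k-th frequencies are close to that of t, so by sparseness these intervals coincide and the
space intervals are disjoint. -/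
theorem IsKTree.sum_len_le_of_long {P₀ P : Finset TriTile} (h₀ : IsSparse P₀) (hsub : P₀ ⊆ P)
    (hP : IsRankOne P) {k : Fin 3} {t : TriTile} {T : Finset TriTile} (h : IsKTree P k t T)
    (hT : T ⊆ P₀) (hlong : ∀ s ∈ T, t.I.len ≤ 10 ^ 9 * s.I.len) :
    ∑ s ∈ T, s.I.len ≤ t.I.len := by
  refine sum_len_le_of_disjoint (fun s hs => TriTile.subset_of_belowEq (h.belowEq s hs)) ?_
  intro a ha b hb hab
  have hlen : ∀ a ∈ T, ∀ b ∈ T, (a.ω k).len < 10 ^ 10 * (b.ω k).len := by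
    intro a ha b hb
    have h₁ := Ivl.len_le_of_subset (TriTile.subset_of_belowEq (h.belowEq b hb))
    have h₂ : b.I.len ≤ 10 ^ 9 * a.I.len := h₁.trans (hlong a ha)
    have h₃ : (a.ω k).len ≤ 10 ^ 9 * (b.ω k).len := by
      have := (TriTile.mul_len_le_iff a b k k (10 ^ 9)⁻¹).2 (by linarith)
      linarith
    linarith [(b.ω k).len_pos]
  have ha' := TriTile.abs_center_le_of_belowEq (h.belowEq a ha)
  have hb' := TriTile.abs_center_le_of_belowEq (h.belowEq b hb)
  have htri := abs_sub_le (a.ω k).center (t.ω k).center (b.ω k).center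
  rw [abs_sub_comm (a.ω k).center (t.ω k).center] at htri
  have := (a.ω k).len_pos
  have := (b.ω k).len_pos
  have := (t.ω k).len_pos
  have hω := Ivl.Sep.eq (h₀.freq a (hT ha) b (hT hb) k) (by linarith) (hlen a ha b hb)
    (hlen b hb a ha)
  rw [Set.disjoint_left]
  intro x hx hx'
  exact hab (h₀.eq_of_mem hsub hP (hT ha) (hT hb) hx hx' hω)

theorem le_sum_singleton {m : Finset TriTile → ℝ} (hm : m ∅ = 0) [DecidableEq TriTile]
    (hadd : ∀ T T', m (T ∪ T') ≤ m T + m T') (T : Finset TriTile) : m T ≤ ∑ s ∈ T, m {s} := by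
  induction T using Finset.induction_on with
  | empty => simp [hm]
  | insert a T ha ih =>
    rw [Finset.sum_insert ha, Finset.insert_eq]
    linarith [hadd {a} T]

/-- Short tri-tiles of trees on the same side of the tops: if their frequency intervals are close,
the order of the tops is determined. -/
theorem center_lt_of_side {P₀ P : Finset TriTile} (h₀ : IsSparse P₀)
    (hsub : P₀ ⊆ P) (hP : IsRankOne P) {j k : Fin 3} (hjk : j ≠ k) {σ : ℝ} (hσ : σ = 1 ∨ σ = -1)
    {s s' t t' : TriTile} (hs : s ∈ P₀) (hs' : s' ∈ P₀) (ht : t ∈ P) (ht' : t' ∈ P)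
    (hst : (s.tile k).BelowEq (t.tile k)) (hst' : (s'.tile k).BelowEq (t'.tile k))
    (hshort : 10 ^ 9 * s'.I.len < t'.I.len)
    (hside : 0 < σ * ((s'.ω j).center - (t'.ω j).center))
    (hl : (s.ω j).len < (s'.ω j).len) (hd : ((s.ω j).dil 2 ∩ (s'.ω j).dil 2).Nonempty) :
    σ * (t'.ω j).center < σ * (t.ω j).center := by
  have hc := Ivl.abs_center_sub_le_of_dil hd
  have p₁ := (s.ω j).len_pos
  have p₂ := (s'.ω j).len_pos
  have p₃ := (t.ω j).len_pos
  have p₄ := (t'.ω j).len_pos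
  have hsep := Ivl.Sep.len_le (h₀.freq s hs s' hs' j) (by linarith) hl
  have hfar := hP.lt_abs_center (hsub hs') ht' hst' hjk hshort
  have hnear := hP.abs_center_le (hsub hs) ht hst j
  have hω : 10 ^ 9 * (t'.ω j).len ≤ (s'.ω j).len :=
    (TriTile.mul_len_le_iff _ _ _ _ _).2 hshort.le
  have hc' := abs_le.1 hc
  have hn' := abs_le.1 hnear
  -- Lacunarity displaces the center of ω_{s'} from that of ω_{t'} by nearly 3/2 |ω_{s'}|. The
  -- overlap of the doubled intervals takes back at most |ω_{s'}| + |ω_s|, and the distance from ω_s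
  -- to ω_t is of order 10^7 |ω_s|, negligible against |ω_{s'}|.
  rcases hσ with rfl | rfl
  · rw [abs_sub_comm, abs_of_pos (by linarith)] at hfar
    linarith
  · rw [abs_of_pos (by linarith)] at hfar
    linarith

/-- At each level a sparse collection is, up to trees of controlled total length, a collection all
of whose `k`-trees have density at most `τ`. -/
theorem exists_good {P₀ P : Finset TriTile} (h₀ : IsSparse P₀)
    (hsub : P₀ ⊆ P) (hP : IsRankOne P) [DecidableEq TriTile] {j k : Fin 3} (hjk : j ≠ k)
    {m : Finset TriTile → ℝ} (hm : m ∅ = 0) (hadd : ∀ T T', m (T ∪ T') ≤ m T + m T') {e : ℝ}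
    (hE : EnergyBound P j k m e) {τ : ℝ} (hτ : 0 < τ) :
    ∃ G ⊆ P₀, (∀ t T, IsKTree P k t T → T ⊆ G → m T ≤ τ * t.I.len) ∧
      CoverBound P (P₀ \ G) (432 * e / τ) := by
  -- A tree splits into its long tri-tiles and the short ones whose j-th frequency lies to the right
  -- or to the left of that of the top. Each part gets a third of the density.
  have hτ' : 0 < τ / 3 := by positivity
  -- Single tri-tiles are selected in order of decreasing length.
  obtain ⟨G₁, hG₁, hno₁, hcov₁⟩ := exists_subset_of_cand h₀ hsub hP hm hE hτ'
    (fun t T => t ∈ P ∧ T = {t} ∧ τ / 3 * t.I.len < m T) (fun t => t.I.len)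
    (by
      rintro t T ⟨ht, rfl, hlt⟩
      exact ⟨isKTree_singleton ht k, hlt⟩)
    (by
      rintro t T t' T' ⟨-, rfl, -⟩ ⟨-, rfl, -⟩ - - s hs s' hs' hl -
      rw [Finset.mem_singleton] at hs hs'
      subst hs hs'
      exact (TriTile.len_lt_iff _ _ _ _).1 hl)
  have hpass : ∀ σ : ℝ, σ = 1 ∨ σ = -1 → ∃ G ⊆ P₀, (∀ t T, T ⊆ G → ¬ (IsKTree P k t T ∧
      (∀ s ∈ T, 10 ^ 9 * s.I.len < t.I.len ∧ 0 < σ * ((s.ω j).center - (t.ω j).center)) ∧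
        τ / 3 * t.I.len < m T)) ∧
      ∀ X ⊆ P₀, Disjoint X G → CoverBound P X (48 * e / (τ / 3)) := by
    intro σ hσ
    -- One-sided short trees are selected with extremal top frequency first: rightmost for σ = 1,
    -- leftmost for σ = -1.
    refine exists_subset_of_cand h₀ hsub hP hm hE hτ' _ (fun t => σ * (t.ω j).center)
      (fun t T h => ⟨h.1, h.2.2⟩) ?_
    rintro t T t' T' ⟨hT, -, -⟩ ⟨hT', hT₂', -⟩ hTP hTP' s hs s' hs' hl hd
    exact center_lt_of_side h₀ hsub hP hjk hσ (hTP hs) (hTP' hs') hT.top_mem hT'.top_mem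
      (hT.belowEq s hs) (hT'.belowEq s' hs') (hT₂' s' hs').1 (hT₂' s' hs').2 hl hd
  obtain ⟨G₂, hG₂, hno₂, hcov₂⟩ := hpass 1 (Or.inl rfl)
  obtain ⟨G₃, hG₃, hno₃, hcov₃⟩ := hpass (-1) (Or.inr rfl)
  refine ⟨G₁ ∩ (G₂ ∩ G₃), Finset.inter_subset_left.trans hG₁, fun t T hT hTG => ?_, ?_⟩
  · have hTP : T ⊆ P₀ := hTG.trans (Finset.inter_subset_left.trans hG₁)
    let U : ℝ → Finset TriTile := fun σ => T.filter fun s =>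
      10 ^ 9 * s.I.len < t.I.len ∧ 0 < σ * ((s.ω j).center - (t.ω j).center)
    let V := T.filter fun s => t.I.len ≤ 10 ^ 9 * s.I.len
    have hU : ∀ σ, U σ ⊆ T := fun σ => Finset.filter_subset _ _
    have hUm : ∀ σ, ∀ s ∈ U σ, 10 ^ 9 * s.I.len < t.I.len ∧
      0 < σ * ((s.ω j).center - (t.ω j).center) := fun σ s hs => (Finset.mem_filter.1 hs).2
    have h₁ : m V ≤ τ / 3 * t.I.len := by
      have hV : V ⊆ T := Finset.filter_subset _ _
      calc m V ≤ ∑ s ∈ V, m {s} := le_sum_singleton hm hadd V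
        _ ≤ ∑ s ∈ V, τ / 3 * s.I.len := Finset.sum_le_sum fun s hs => by
            have hsG := Finset.inter_subset_left (hTG (hV hs))
            by_contra hcon
            exact hno₁ s {s} (Finset.singleton_subset_iff.2 hsG)
              ⟨hsub (hG₁ hsG), rfl, not_le.1 hcon⟩
        _ = τ / 3 * ∑ s ∈ V, s.I.len := (Finset.mul_sum _ _ _).symm
        _ ≤ τ / 3 * t.I.len := mul_le_mul_of_nonneg_left
            ((hT.mono hV).sum_len_le_of_long h₀ hsub hP (hV.trans hTP)
              fun s hs => (Finset.mem_filter.1 hs).2) hτ'.le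
    have h₂ : m (U 1) ≤ τ / 3 * t.I.len := by
      by_contra hcon
      exact hno₂ t (U 1) ((hU 1).trans (hTG.trans
        (Finset.inter_subset_right.trans Finset.inter_subset_left)))
        ⟨hT.mono (hU 1), hUm 1, not_le.1 hcon⟩
    have h₃ : m (U (-1)) ≤ τ / 3 * t.I.len := by
      by_contra hcon
      exact hno₃ t (U (-1)) ((hU (-1)).trans (hTG.trans
        (Finset.inter_subset_right.trans Finset.inter_subset_right)))
        ⟨hT.mono (hU (-1)), hUm (-1), not_le.1 hcon⟩
    have hTeq : T = V ∪ (U 1 ∪ U (-1)) := by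
      refine Finset.Subset.antisymm (fun s hs => ?_) (Finset.union_subset
        (Finset.filter_subset _ _) (Finset.union_subset (hU 1) (hU (-1))))
      simp only [V, U, Finset.mem_union, Finset.mem_filter, hs, true_and]
      rcases le_or_gt t.I.len (10 ^ 9 * s.I.len) with h | h
      · exact Or.inl h
      · right
        have hfar := hP.lt_abs_center (hsub (hTP hs)) hT.top_mem (hT.belowEq s hs) hjk h
        have hlt : (t.ω j).len < (s.ω j).len := (TriTile.len_lt_iff _ _ _ _).2
          (by linarith [s.I.len_pos])
        have hpos : 0 < |(t.ω j).center - (s.ω j).center| := by linarith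
        rcases lt_or_gt_of_ne (sub_ne_zero.1 (abs_pos.1 hpos)) with h' | h'
        · exact Or.inl ⟨h, by linarith⟩
        · exact Or.inr ⟨h, by linarith⟩
    have h₄ := hadd V (U 1 ∪ U (-1))
    have h₅ := hadd (U 1) (U (-1))
    rw [← hTeq] at h₄
    linarith
  · have hd : ∀ G : Finset TriTile, Disjoint (P₀ \ G) G := fun G => Finset.sdiff_disjoint
    have h := ((hcov₁ _ Finset.sdiff_subset (hd G₁)).of_subset_union
      ((hcov₂ _ Finset.sdiff_subset (hd G₂)).of_subset_union
        (hcov₃ _ Finset.sdiff_subset (hd G₃)) subset_rfl) (X := P₀ \ (G₁ ∩ (G₂ ∩ G₃))) (by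
          rw [Finset.sdiff_inter_distrib_right, Finset.sdiff_inter_distrib_right]))
    -- Three passes at density τ/3 cost 3 · 48 e / (τ/3) = 432 e / τ.
    exact h.mono subset_rfl (le_of_eq (by field_simp; ring))

/-! ### Summation over the levels -/

/-- A geometric series decaying in both directions away from the n with 2^n x ≈ 1. The bound does
not depend on x, which only shifts the series. -/
theorem exists_sum_min_rpow_le {a b : ℝ} (ha : 0 < a) (hb : 0 < b) :
    ∃ C : ℝ, 0 ≤ C ∧ ∀ x : ℝ, 0 < x → ∀ F : Finset ℤ,
      ∑ n ∈ F, min (((2 : ℝ) ^ n * x) ^ a) (((2 : ℝ) ^ n * x) ^ (-b)) ≤ C := by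
  set q : ℝ := max (2 ^ (-a)) (2 ^ (-b)) with hq
  have hq0 : 0 ≤ q := le_max_of_le_left (by positivity)
  have hq1 : q < 1 := max_lt (Real.rpow_lt_one_of_one_lt_of_neg (by norm_num) (by linarith))
    (Real.rpow_lt_one_of_one_lt_of_neg (by norm_num) (by linarith))
  have hsum : Summable fun n : ℤ => (2 : ℝ) ^ a * q ^ n.natAbs := by
    refine Summable.mul_left _ (Summable.of_nat_of_neg ?_ ?_)
    · simpa using summable_geometric_of_lt_one hq0 hq1
    · simpa using summable_geometric_of_lt_one hq0 hq1
  have hone : (1 : ℝ) ≤ 2 ^ a := Real.one_le_rpow (by norm_num) ha.le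
  refine ⟨∑' n : ℤ, (2 : ℝ) ^ a * q ^ n.natAbs, tsum_nonneg fun n => by positivity,
    fun x hx F => ?_⟩
  obtain ⟨m, hm₁, hm₂⟩ := exists_mem_Ico_zpow hx (by norm_num : (1 : ℝ) < 2)
  have hterm : ∀ n : ℤ, min (((2 : ℝ) ^ n * x) ^ a) (((2 : ℝ) ^ n * x) ^ (-b)) ≤
      2 ^ a * q ^ (n + m).natAbs := by
    intro n
    have hlo : (2 : ℝ) ^ (n + m) ≤ 2 ^ n * x := by
      rw [zpow_add₀ two_ne_zero]
      gcongr
    have hhi : (2 : ℝ) ^ n * x ≤ 2 ^ (n + m + 1) := by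
      rw [add_assoc, zpow_add₀ two_ne_zero]
      gcongr
    rcases le_or_gt 0 (n + m) with h | h
    · obtain ⟨l, hl⟩ := Int.eq_ofNat_of_zero_le h
      refine (min_le_right _ _).trans ?_
      rw [hl] at hlo ⊢
      calc ((2 : ℝ) ^ n * x) ^ (-b) ≤ ((2 : ℝ) ^ (l : ℤ)) ^ (-b) :=
            Real.rpow_le_rpow_of_nonpos (by positivity) hlo (by linarith)
        _ = ((2 : ℝ) ^ (-b)) ^ l := by
            rw [zpow_natCast, ← Real.rpow_natCast, ← Real.rpow_natCast, ← Real.rpow_mul (by norm_num),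
              ← Real.rpow_mul (by norm_num), mul_comm]
        _ ≤ q ^ l := pow_le_pow_left₀ (by positivity) (le_max_right _ _) l
        _ ≤ 2 ^ a * q ^ l := le_mul_of_one_le_left (by positivity) hone
        _ = _ := by simp
    · obtain ⟨l, hl⟩ := Int.eq_ofNat_of_zero_le (neg_nonneg.2 h.le)
      have hl' : n + m = -(l : ℤ) := by omega
      refine (min_le_left _ _).trans ?_
      rw [hl'] at hhi ⊢
      calc ((2 : ℝ) ^ n * x) ^ a ≤ ((2 : ℝ) ^ (-(l : ℤ) + 1)) ^ a :=
            Real.rpow_le_rpow (by positivity) hhi ha.le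
        _ = 2 ^ a * ((2 : ℝ) ^ (-a)) ^ l := by
            rw [zpow_add_one₀ two_ne_zero, Real.mul_rpow (by positivity) (by norm_num), zpow_neg,
              zpow_natCast, mul_comm, Real.rpow_neg (by norm_num), inv_pow,
              Real.inv_rpow (by positivity), ← Real.rpow_natCast, ← Real.rpow_natCast,
              ← Real.rpow_mul (by norm_num), ← Real.rpow_mul (by norm_num), mul_comm (l : ℝ)]
        _ ≤ 2 ^ a * q ^ l := by
            gcongr
            exact le_max_left _ _
        _ = _ := by simp
  calc _ ≤ ∑ n ∈ F, (2 : ℝ) ^ a * q ^ (n + m).natAbs := Finset.sum_le_sum fun n _ => hterm n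
    _ = ∑ n ∈ F.map (addRightEmbedding m), (2 : ℝ) ^ a * q ^ n.natAbs := by simp
    _ ≤ _ := hsum.sum_le_tsum _ fun n _ => by positivity

theorem min_le_rpow_mul_rpow {s u θ : ℝ} (hs : 0 < s) (hu : 0 < u) (h₀ : 0 ≤ θ) (h₁ : θ ≤ 1) :
    min s u ≤ u ^ (1 - θ) * s ^ θ := by
  have hm : 0 < min s u := lt_min hs hu
  calc min s u = (min s u) ^ (1 - θ) * (min s u) ^ θ := by
        rw [← Real.rpow_add hm, sub_add_cancel, Real.rpow_one]
    _ ≤ u ^ (1 - θ) * s ^ θ := mul_le_mul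
        (Real.rpow_le_rpow hm.le (min_le_right _ _) (by linarith))
        (Real.rpow_le_rpow hm.le (min_le_left _ _) h₀) (by positivity) (by positivity)

/-- An identity in disguise: the last factor is the exact loss in the interpolation of the minimum,
and it decays when s and u are far apart if 0 < θ < 1. -/
theorem min_le_rpow_mul_rpow_mul_min {s u θ : ℝ} (hs : 0 < s) (hu : 0 < u) :
    min s u ≤ u ^ (1 - θ) * s ^ θ * min ((s / u) ^ (1 - θ)) ((s / u) ^ (-θ)) := by
  have h₁ : u ^ (1 - θ) * s ^ θ * (s / u) ^ (1 - θ) = s := by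
    rw [Real.div_rpow hs.le hu.le]
    have : s ^ θ * s ^ (1 - θ) = s := by rw [← Real.rpow_add hs]; simp
    have hne : u ^ (1 - θ) ≠ 0 := (Real.rpow_pos_of_pos hu _).ne'
    field_simp
    linarith
  have h₂ : u ^ (1 - θ) * s ^ θ * (s / u) ^ (-θ) = u := by
    rw [Real.div_rpow hs.le hu.le, Real.rpow_neg hs.le, Real.rpow_neg hu.le]
    have : u ^ (1 - θ) * u ^ θ = u := by rw [← Real.rpow_add hu]; simp
    have hne : u ^ θ ≠ 0 := (Real.rpow_pos_of_pos hu _).ne'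
    have hne' : s ^ θ ≠ 0 := (Real.rpow_pos_of_pos hs _).ne'
    field_simp
    linarith
  rw [mul_min_of_nonneg _ _ (by positivity), h₁, h₂]

/-- One minimum is interpolated with its gain, which is summable over the levels; the other two are
interpolated without gain. -/
theorem exists_sum_levels_le {θ : Fin 3 → ℝ} (hθ : ∀ j, 0 < θ j) (hθ₁ : ∑ j, θ j = 1) :
    ∃ C : ℝ, 0 ≤ C ∧ ∀ E s : Fin 3 → ℝ, (∀ j, 0 < E j) → (∀ j, 0 < s j) → ∀ F : Finset ℤ,
      ∑ n ∈ F, (4 : ℝ) ^ n * ∏ j, min (s j) (2 ^ (-n) * E j) ≤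
        C * ∏ j, (E j ^ (1 - θ j) * s j ^ θ j) := by
  rw [Fin.sum_univ_three] at hθ₁
  have h0 := hθ 0
  have h1 := hθ 1
  have h2 := hθ 2
  obtain ⟨C, hC, hmin⟩ := exists_sum_min_rpow_le (a := 1 - θ 0) (b := θ 0) (by linarith) h0
  refine ⟨C, hC, fun E s hE hs F => ?_⟩
  set M := ∏ j, (E j ^ (1 - θ j) * s j ^ θ j) with hM
  have hM0 : 0 ≤ M := Finset.prod_nonneg fun j _ =>
    mul_nonneg (Real.rpow_nonneg (hE j).le _) (Real.rpow_nonneg (hs j).le _)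
  have hx : 0 < s 0 / E 0 := div_pos (hs 0) (hE 0)
  have hterm : ∀ n : ℤ, (4 : ℝ) ^ n * ∏ j, min (s j) (2 ^ (-n) * E j) ≤
      M * min (((2 : ℝ) ^ n * (s 0 / E 0)) ^ (1 - θ 0)) (((2 : ℝ) ^ n * (s 0 / E 0)) ^ (-θ 0)) := by
    intro n
    have hp : (0 : ℝ) < 2 ^ (-n) := by positivity
    have hu : ∀ j, 0 < 2 ^ (-n) * E j := fun j => mul_pos hp (hE j)
    have hdiv : s 0 / (2 ^ (-n) * E 0) = 2 ^ n * (s 0 / E 0) := by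
      rw [zpow_neg]
      have := hE 0
      field_simp
    have e₀ := min_le_rpow_mul_rpow_mul_min (θ := θ 0) (hs 0) (hu 0)
    rw [hdiv] at e₀
    have e₁ := min_le_rpow_mul_rpow (hs 1) (hu 1) h1.le (by linarith)
    have e₂ := min_le_rpow_mul_rpow (hs 2) (hu 2) h2.le (by linarith)
    rw [hM, Fin.prod_univ_three, Fin.prod_univ_three]
    set y := min (((2 : ℝ) ^ n * (s 0 / E 0)) ^ (1 - θ 0))
      (((2 : ℝ) ^ n * (s 0 / E 0)) ^ (-θ 0)) with hy
    have hy0 : 0 ≤ y := le_min (by positivity) (by positivity)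
    have hpow : ∀ j, (2 ^ (-n) * E j) ^ (1 - θ j) =
        ((2 : ℝ) ^ (-n)) ^ (1 - θ j) * E j ^ (1 - θ j) := fun j =>
      Real.mul_rpow hp.le (hE j).le
    rw [hpow] at e₀ e₁ e₂
    -- The exponents 1 - θ_j add up to 2, so the powers of 2^{-n} cancel 4^n exactly.
    have h4 : (4 : ℝ) ^ n * (((2 : ℝ) ^ (-n)) ^ (1 - θ 0) * ((2 : ℝ) ^ (-n)) ^ (1 - θ 1) *
        ((2 : ℝ) ^ (-n)) ^ (1 - θ 2)) = 1 := by
      rw [← Real.rpow_add hp, ← Real.rpow_add hp,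
        show 1 - θ 0 + (1 - θ 1) + (1 - θ 2) = ((2 : ℕ) : ℝ) by push_cast; linarith,
        Real.rpow_natCast, zpow_neg, inv_pow, show (4 : ℝ) = 2 ^ (2 : ℤ) by norm_num,
        ← zpow_mul, mul_comm, ← zpow_natCast, ← zpow_mul, mul_comm n]
      exact inv_mul_cancel₀ (by positivity)
    have hs0 := hs 0
    have hs1 := hs 1
    have hs2 := hs 2
    have hE0 := hE 0
    have hE1 := hE 1
    have hE2 := hE 2
    calc _ ≤ (4 : ℝ) ^ n * ((((2 : ℝ) ^ (-n)) ^ (1 - θ 0) * E 0 ^ (1 - θ 0) * s 0 ^ θ 0 * y) *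
          (((2 : ℝ) ^ (-n)) ^ (1 - θ 1) * E 1 ^ (1 - θ 1) * s 1 ^ θ 1) *
          (((2 : ℝ) ^ (-n)) ^ (1 - θ 2) * E 2 ^ (1 - θ 2) * s 2 ^ θ 2)) := by
          gcongr
      _ = ((4 : ℝ) ^ n * (((2 : ℝ) ^ (-n)) ^ (1 - θ 0) * ((2 : ℝ) ^ (-n)) ^ (1 - θ 1) *
        ((2 : ℝ) ^ (-n)) ^ (1 - θ 2))) * (E 0 ^ (1 - θ 0) * s 0 ^ θ 0 *
          (E 1 ^ (1 - θ 1) * s 1 ^ θ 1) * (E 2 ^ (1 - θ 2) * s 2 ^ θ 2) * y) := by ring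
      _ = _ := by rw [h4, one_mul]
  calc _ ≤ ∑ n ∈ F, M * min (((2 : ℝ) ^ n * (s 0 / E 0)) ^ (1 - θ 0))
        (((2 : ℝ) ^ n * (s 0 / E 0)) ^ (-θ 0)) := Finset.sum_le_sum fun n _ => hterm n
    _ = M * ∑ n ∈ F, min (((2 : ℝ) ^ n * (s 0 / E 0)) ^ (1 - θ 0))
        (((2 : ℝ) ^ n * (s 0 / E 0)) ^ (-θ 0)) := (Finset.mul_sum _ _ _).symm
    _ ≤ M * C := mul_le_mul_of_nonneg_left (hmin _ hx F) hM0
    _ = C * M := mul_comm _ _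

end BilinearSquare

namespace BilinearSquare

/-! ### The estimate for a rank one collection in a single strip -/

/-- Coefficients `W` on the tri-tiles of `P`, dominated on trees by the subadditive `m`. -/
structure IsTreeMass (P : Finset TriTile) (m : Fin 3 → Finset TriTile → ℝ)
    (W : Fin 3 → TriTile → ℝ) : Prop where
  empty : ∀ j, m j ∅ = 0
  union : ∀ [DecidableEq TriTile], ∀ j T T', m j (T ∪ T') ≤ m j T + m j T'
  nonneg : ∀ j s, 0 ≤ W j s
  sum_le : ∀ j k, k ≠ j → ∀ t T, IsKTree P k t T → ∑ s ∈ T, W j s ≤ m j T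

/-- The contribution of a tri-tile to the form. -/
noncomputable def weight (W : Fin 3 → TriTile → ℝ) (s : TriTile) : ℝ :=
  s.I.len ^ (-(1 / 2) : ℝ) * ∏ j, Real.sqrt (W j s)

theorem weight_nonneg (W : Fin 3 → TriTile → ℝ) (s : TriTile) : 0 ≤ weight W s :=
  mul_nonneg (Real.rpow_nonneg s.I.len_pos.le _) (Finset.prod_nonneg fun _ _ => Real.sqrt_nonneg _)

theorem exists_ne_of_fin_three (k : Fin 3) : ∃ i l : Fin 3, i ≠ k ∧ l ≠ k ∧
    ∀ f : Fin 3 → ℝ, ∏ j, f j = f k * (f i * f l) := by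
  fin_cases k
  · exact ⟨1, 2, by decide, by decide, fun f => by simp [Fin.prod_univ_three, mul_assoc]⟩
  · exact ⟨0, 2, by decide, by decide, fun f => by simp [Fin.prod_univ_three]; ring⟩
  · exact ⟨0, 1, by decide, by decide, fun f => by simp [Fin.prod_univ_three]; ring⟩

variable {P : Finset TriTile} {m : Fin 3 → Finset TriTile → ℝ} {W : Fin 3 → TriTile → ℝ}

theorem IsTreeMass.le_singleton (h : IsTreeMass P m W) {s : TriTile} (hs : s ∈ P) {j k : Fin 3}
    (hk : k ≠ j) : W j s ≤ m j {s} := by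
  simpa using h.sum_le j k hk s {s} (isKTree_singleton hs k)

/-- On a k-tree the mass bounds are available only for the two indices other than k, and these
factors are summed by Cauchy–Schwarz. The k-th factor is bounded tile by tile, since a single
tri-tile is an i-tree for every i. -/
theorem IsTreeMass.sum_weight_le (h : IsTreeMass P m W) {G : Finset TriTile} {b : Fin 3 → ℝ}
    (hb : ∀ j, 0 ≤ b j)
    (hG : ∀ j k, k ≠ j → ∀ t T, IsKTree P k t T → T ⊆ G → m j T ≤ b j ^ 2 * t.I.len)
    {k : Fin 3} {t : TriTile} {T : Finset TriTile} (hT : IsKTree P k t T) (hTG : T ⊆ G) :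
    ∑ s ∈ T, weight W s ≤ (∏ j, b j) * t.I.len := by
  obtain ⟨i, l, hi, hl, hprod⟩ := exists_ne_of_fin_three k
  have hsingle : ∀ s ∈ T, s.I.len ^ (-(1 / 2) : ℝ) * √(W k s) ≤ b k := by
    intro s hs
    have hpos := s.I.len_pos
    have h₁ := (h.le_singleton (hT.subset hs) hi).trans (hG k i hi s {s}
      (isKTree_singleton (hT.subset hs) i) (Finset.singleton_subset_iff.2 (hTG hs)))
    have h₂ := Real.sqrt_le_sqrt h₁
    rw [Real.sqrt_mul (sq_nonneg _), Real.sqrt_sq (hb k)] at h₂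
    rw [Real.rpow_neg hpos.le, ← Real.sqrt_eq_rpow, inv_mul_le_iff₀ (Real.sqrt_pos.2 hpos),
      mul_comm]
    exact h₂
  have hmass : ∀ j, j ≠ k → √(∑ s ∈ T, W j s) ≤ b j * √t.I.len := by
    intro j hj
    have := Real.sqrt_le_sqrt ((h.sum_le j k hj.symm t T hT).trans
      (hG j k hj.symm t T hT hTG))
    rwa [Real.sqrt_mul (sq_nonneg _), Real.sqrt_sq (hb j)] at this
  calc ∑ s ∈ T, weight W s
      = ∑ s ∈ T, s.I.len ^ (-(1 / 2) : ℝ) * √(W k s) * (√(W i s) * √(W l s)) :=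
        Finset.sum_congr rfl fun s _ => by
          rw [weight, hprod fun j => √(W j s)]; ring
    _ ≤ ∑ s ∈ T, b k * (√(W i s) * √(W l s)) := Finset.sum_le_sum fun s hs =>
        mul_le_mul_of_nonneg_right (hsingle s hs) (by positivity)
    _ = b k * ∑ s ∈ T, √(W i s) * √(W l s) := (Finset.mul_sum _ _ _).symm
    _ ≤ b k * (√(∑ s ∈ T, W i s) * √(∑ s ∈ T, W l s)) := mul_le_mul_of_nonneg_left
        (Real.sum_sqrt_mul_sqrt_le T (fun s => h.nonneg i s) (fun s => h.nonneg l s)) (hb k)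
    _ ≤ b k * ((b i * √t.I.len) * (b l * √t.I.len)) := by
        have := hb k
        have := hb i
        gcongr
        · exact hmass i hi
        · exact hmass l hl
    _ = (b k * (b i * b l)) * (√t.I.len * √t.I.len) := by ring
    _ = (∏ j, b j) * t.I.len := by
        rw [Real.mul_self_sqrt t.I.len_pos.le, hprod b]

/-- Test the cover with the function that equals |I_s| at s and vanishes elsewhere. -/
theorem CoverBound.len_le {X : Finset TriTile} {M : ℝ} (h : CoverBound P X M) {s : TriTile}
    (hs : s ∈ X) : s.I.len ≤ M := by
  classical
  have := h 1 (fun x => if x = s then s.I.len else 0) zero_le_one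
    (fun x => by
      split_ifs
      · exact s.I.len_pos.le
      · exact le_rfl)
    (fun k t T hT => by
      rw [Finset.sum_ite_eq' T s fun _ => s.I.len, one_mul]
      split_ifs with hsT
      · exact Ivl.len_le_of_subset (TriTile.subset_of_belowEq (hT.belowEq s hsT))
      · exact t.I.len_pos.le)
  rw [Finset.sum_ite_eq' X s fun _ => s.I.len, if_pos hs, one_mul] at this
  exact this

theorem isSparse_singleton (s : TriTile) : IsSparse {s} := by
  constructor
  · intro a ha b hb
    rw [Finset.mem_singleton.1 ha, Finset.mem_singleton.1 hb]
    exact Or.inl rfl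
  · intro a ha b hb j
    rw [Finset.mem_singleton.1 ha, Finset.mem_singleton.1 hb]
    exact Or.inl rfl

/-- At zero energy the selection on the sparse collection {s} can remove nothing of positive length.
Thus s survives at every density level, however small. -/
theorem IsTreeMass.eq_zero_of_energy (h : IsTreeMass P m W) (hP : IsRankOne P) {j k : Fin 3}
    (hk : k ≠ j) (hE : EnergyBound P j k (m j) 0) {s : TriTile} (hs : s ∈ P) : W j s = 0 := by
  classical
  refine le_antisymm (le_of_forall_pos_le_add fun ε hε => ?_) (h.nonneg j s)
  have hpos := s.I.len_pos
  obtain ⟨G, -, hG, hcov⟩ := exists_good (isSparse_singleton s) (Finset.singleton_subset_iff.2 hs)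
    hP hk.symm (h.empty j) (h.union j) hE (div_pos hε hpos)
  have hsG : s ∈ G := by
    by_contra hcon
    have := hcov.len_le (s := s) (by simp [hcon])
    simp only [mul_zero, zero_div] at this
    linarith
  have h₁ := hG s {s} (isKTree_singleton hs k) (Finset.singleton_subset_iff.2 hsG)
  rw [div_mul_cancel₀ _ hpos.ne'] at h₁
  rw [zero_add]
  exact (h.le_singleton hs hk).trans h₁

/-- Intersect the good sets of all pairs (j, k). The densities (2^{-n} E_j)² are proportional to the
squared energies, so every pair costs the same multiple of 4^n. -/
theorem IsTreeMass.exists_level (h : IsTreeMass P m W) (hP : IsRankOne P) {P₀ : Finset TriTile}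
    (h₀ : IsSparse P₀) (hsub : P₀ ⊆ P) [DecidableEq TriTile] {E : Fin 3 → ℝ} (hE : ∀ j, 0 < E j)
    (hen : ∀ j k, k ≠ j → EnergyBound P j k (m j) (E j ^ 2)) (n : ℤ) :
    ∃ G ⊆ P₀, (∀ j k, k ≠ j → ∀ t T, IsKTree P k t T → T ⊆ G →
        m j T ≤ (2 ^ (-n) * E j) ^ 2 * t.I.len) ∧
      CoverBound P (P₀ \ G) (3888 * 4 ^ n) := by
  classical
  have hex : ∀ p : Fin 3 × Fin 3, ∃ G ⊆ P₀, (p.2 ≠ p.1 → ∀ t T, IsKTree P p.2 t T → T ⊆ G →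
      m p.1 T ≤ (2 ^ (-n) * E p.1) ^ 2 * t.I.len) ∧ CoverBound P (P₀ \ G) (432 * 4 ^ n) := by
    rintro ⟨j, k⟩
    by_cases hjk : k = j
    · refine ⟨P₀, subset_rfl, fun hne => absurd hjk hne, ?_⟩
      intro β F hβ _ _
      simp only [sdiff_self, Finset.bot_eq_empty, Finset.sum_empty]
      positivity
    · have hEj := hE j
      obtain ⟨G, hG, hT, hcov⟩ := exists_good h₀ hsub hP (Ne.symm hjk) (h.empty j) (h.union j)
        (hen j k hjk) (τ := (2 ^ (-n) * E j) ^ 2) (by positivity)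
      refine ⟨G, hG, fun _ => hT, hcov.mono subset_rfl (le_of_eq ?_)⟩
      rw [show (4 : ℝ) = 2 ^ (2 : ℤ) by norm_num, ← zpow_mul, zpow_neg, mul_comm 2 n, zpow_mul]
      norm_cast
      field_simp
  choose G hG hT hcov using hex
  refine ⟨P₀.filter fun s => ∀ p, s ∈ G p, Finset.filter_subset _ _,
    fun j k hk t T hkt hTG => ?_, ?_⟩
  · exact hT (j, k) hk t T hkt fun s hs => (Finset.mem_filter.1 (hTG hs)).2 (j, k)
  · refine (CoverBound.of_subset_biUnion (D := Finset.univ) (Y := fun p => P₀ \ G p)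
      (fun p _ => hcov p) fun s hs => ?_).mono subset_rfl (le_of_eq ?_)
    · obtain ⟨hs₁, hs₂⟩ := Finset.mem_sdiff.1 hs
      by_contra hcon
      refine hs₂ (Finset.mem_filter.2 ⟨hs₁, fun p => ?_⟩)
      by_contra hp
      exact hcon (Finset.mem_biUnion.2 ⟨p, Finset.mem_univ p, Finset.mem_sdiff.2 ⟨hs₁, hp⟩⟩)
    -- There are nine pairs, the diagonal ones trivial: 9 · 432 = 3888.
    · simp
      ring

theorem exists_int_mem_notMem {p : ℤ → Prop} {a b : ℤ} (hab : a ≤ b) (ha : p a) (hb : ¬ p b) :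
    ∃ n, p n ∧ ¬ p (n + 1) := by
  by_contra! h
  exact hb (Int.leInduction (m := a) (motive := fun n _ => p n) ha (fun n _ hn => h n hn) b hab)

theorem exists_sum_sparse_le {θ : Fin 3 → ℝ} (hθ : ∀ j, 0 < θ j) (hθ₁ : ∑ j, θ j = 1) :
    ∃ C : ℝ, 0 ≤ C ∧ ∀ (P : Finset TriTile) (m : Fin 3 → Finset TriTile → ℝ)
      (W : Fin 3 → TriTile → ℝ), IsTreeMass P m W → IsRankOne P →
      ∀ P₀ ⊆ P, IsSparse P₀ → ∀ E σ : Fin 3 → ℝ, (∀ j, 0 < E j) → (∀ j, 0 < σ j) →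
      (∀ j k, k ≠ j → EnergyBound P j k (m j) (E j ^ 2)) →
      (∀ j k, k ≠ j → ∀ t T, IsKTree P k t T → m j T ≤ σ j ^ 2 * t.I.len) →
      ∑ s ∈ P₀, weight W s ≤ C * ∏ j, (E j ^ (1 - θ j) * σ j ^ θ j) := by
  classical
  obtain ⟨C, hC, hlev⟩ := exists_sum_levels_le hθ hθ₁
  -- 15552 = 4 · 3888, since the piece of level n lies outside G (n + 1).
  refine ⟨15552 * C, by positivity, fun P m W h hP P₀ hsub h₀ E σ hE hσ hen hsize => ?_⟩
  choose G hG hGT hcov using fun n => h.exists_level hP h₀ hsub hE hen n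
  -- The sets G n need not be nested, but s lies in G n for some very negative n, where the cover of
  -- the complement is shorter than I_s, and fails to for some large n, where the density bound is
  -- below W_1(s). Somewhere in between it leaves.
  have hn : ∀ s : TriTile, ∃ n : ℤ, s ∈ P₀ → weight W s ≠ 0 → s ∈ G n ∧ s ∉ G (n + 1) := by
    intro s
    by_cases hs : s ∈ P₀ ∧ weight W s ≠ 0
    swap
    · exact ⟨0, fun h₁ h₂ => absurd ⟨h₁, h₂⟩ hs⟩
    obtain ⟨hs, hw⟩ := hs
    have hpos := s.I.len_pos
    have hW : 0 < W 0 s := by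
      refine lt_of_le_of_ne (h.nonneg 0 s) fun h0 => hw ?_
      rw [weight, Finset.prod_eq_zero (Finset.mem_univ 0), mul_zero]
      rw [← h0, Real.sqrt_zero]
    obtain ⟨l, hl⟩ := exists_pow_lt_of_lt_one (div_pos hpos (by norm_num : (0 : ℝ) < 3888))
      (by norm_num : (1 / 4 : ℝ) < 1)
    have hE0 := hE 0
    obtain ⟨r, hr⟩ := exists_pow_lt_of_lt_one (div_pos hW (mul_pos (pow_pos hE0 2) hpos))
      (by norm_num : (1 / 4 : ℝ) < 1)
    have ha : s ∈ G (-l) := by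
      by_contra hcon
      have h₁ := (hcov (-l)).len_le (Finset.mem_sdiff.2 ⟨hs, hcon⟩)
      rw [lt_div_iff₀ (by norm_num), one_div, inv_pow] at hl
      rw [zpow_neg, zpow_natCast] at h₁
      linarith
    have hb : s ∉ G r := by
      intro hcon
      have h₁ := (h.le_singleton (hsub hs) (by decide : (1 : Fin 3) ≠ 0)).trans
        (hGT r 0 1 (by decide) s {s} (isKTree_singleton (hsub hs) 1)
          (Finset.singleton_subset_iff.2 hcon))
      rw [lt_div_iff₀ (by positivity)] at hr
      have h₂ : ((2 : ℝ) ^ (-(r : ℤ)) * E 0) ^ 2 * s.I.len = (1 / 4) ^ r * (E 0 ^ 2 * s.I.len) := by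
        rw [zpow_neg, zpow_natCast, mul_pow, inv_pow, ← pow_mul, mul_comm r, pow_mul, one_div,
          inv_pow]
        norm_num
        ring
      linarith
    obtain ⟨n, hn⟩ := exists_int_mem_notMem (p := fun n => s ∈ G n) (by omega) ha hb
    exact ⟨n, fun _ _ => hn⟩
  choose ν hν using hn
  set P₁ := P₀.filter fun s => weight W s ≠ 0 with hP₁
  let b : ℤ → Fin 3 → ℝ := fun n j => min (σ j) (2 ^ (-n) * E j)
  have hb : ∀ n j, 0 ≤ b n j := fun n j =>
    le_min (hσ j).le (mul_nonneg (by positivity) (hE j).le)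
  have hlevel : ∀ n : ℤ, ∑ s ∈ P₁ with ν s = n, weight W s ≤
      15552 * (4 ^ n * ∏ j, b n j) := by
    intro n
    have hβ : 0 ≤ ∏ j, b n j := Finset.prod_nonneg fun j _ => hb n j
    have hsq : ∀ j k, k ≠ j → ∀ t T, IsKTree P k t T → T ⊆ G n →
        m j T ≤ b n j ^ 2 * t.I.len := by
      intro j k hk t T hT hTG
      rcases min_choice (σ j) (2 ^ (-n) * E j) with he | he
      · simp only [b, he]
        exact hsize j k hk t T hT
      · simp only [b, he]
        exact hGT n j k hk t T hT hTG
    -- The cover of the complement of G (n + 1) is tested with the weight restricted to G n, where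
    -- all tree densities are controlled.
    have h₁ := hcov (n + 1) (∏ j, b n j) (fun s => if s ∈ G n then weight W s else 0) hβ
      (fun s => by
        split_ifs
        · exact weight_nonneg W s
        · exact le_rfl)
      (fun k t T hT => by
        rw [← Finset.sum_filter]
        exact h.sum_weight_le (hb n) hsq (hT.mono (Finset.filter_subset _ _))
          fun s hs => (Finset.mem_filter.1 hs).2)
    calc _ ≤ ∑ s ∈ P₀ \ G (n + 1), (if s ∈ G n then weight W s else 0) := by
          rw [← Finset.sum_filter]
          refine Finset.sum_le_sum_of_subset_of_nonneg (fun s hs => ?_)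
            fun s _ _ => weight_nonneg W s
          obtain ⟨hs₁, rfl⟩ := Finset.mem_filter.1 hs
          obtain ⟨hs', hw⟩ := Finset.mem_filter.1 hs₁
          obtain ⟨h₂, h₃⟩ := hν s hs' hw
          exact Finset.mem_filter.2 ⟨Finset.mem_sdiff.2 ⟨hs', h₃⟩, h₂⟩
      _ ≤ _ := h₁
      _ = _ := by
          rw [zpow_add_one₀ (by norm_num)]
          ring
  calc ∑ s ∈ P₀, weight W s = ∑ s ∈ P₁, weight W s := (Finset.sum_filter_ne_zero _).symm
    _ = ∑ n ∈ P₁.image ν, ∑ s ∈ P₁ with ν s = n, weight W s :=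
        (Finset.sum_fiberwise_of_maps_to (fun s hs => Finset.mem_image_of_mem ν hs) _).symm
    _ ≤ ∑ n ∈ P₁.image ν, 15552 * (4 ^ n * ∏ j, b n j) := Finset.sum_le_sum fun n _ => hlevel n
    _ = 15552 * ∑ n ∈ P₁.image ν, 4 ^ n * ∏ j, b n j := (Finset.mul_sum _ _ _).symm
    _ ≤ 15552 * (C * ∏ j, (E j ^ (1 - θ j) * σ j ^ θ j)) :=
        mul_le_mul_of_nonneg_left (hlev E σ hE hσ _) (by norm_num)
    _ = _ := by ring

/-- The estimate for a rank one collection whose intervals form grids. -/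
theorem exists_ofReal_sum_weight_le (A : ℕ) {θ : Fin 3 → ℝ} (hθ : ∀ j, 0 < θ j)
    (hθ₁ : ∑ j, θ j = 1) :
    ∃ C : ℝ≥0, ∀ (P : Finset TriTile) (m : Fin 3 → Finset TriTile → ℝ)
      (W : Fin 3 → TriTile → ℝ), IsTreeMass P m W → IsRankOne P →
      IsGrid A {I | ∃ s ∈ P, I = s.I} → IsGrid A {w | ∃ s ∈ P, ∃ j, w = s.ω j} →
      ∀ E σ : Fin 3 → ℝ≥0∞,
      (∀ j k, k ≠ j → E j ≠ ⊤ → EnergyBound P j k (m j) ((E j).toReal ^ 2)) →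
      (∀ j k, k ≠ j → σ j ≠ ⊤ → ∀ t T, IsKTree P k t T → m j T ≤ (σ j).toReal ^ 2 * t.I.len) →
      ENNReal.ofReal (∑ s ∈ P, weight W s) ≤ C * ∏ j, (E j ^ (1 - θ j) * σ j ^ θ j) := by
  obtain ⟨C, hC, hle⟩ := exists_sum_sparse_le hθ hθ₁
  -- The summand 1 keeps the constant positive, so that it can multiply an infinite right-hand side.
  refine ⟨(numClasses A * C).toNNReal + 1, fun P m W h hP hgI hgω E σ hen hsize => ?_⟩
  have hθlt : ∀ j, 0 < 1 - θ j := by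
    have h0 := hθ 0
    have h1 := hθ 1
    have h2 := hθ 2
    rw [Fin.sum_univ_three] at hθ₁
    intro j
    fin_cases j <;> simp <;> linarith
  -- A vanishing factor annihilates even infinite ones in `ℝ≥0∞`, so here the left-hand side has to
  -- be shown to vanish.
  by_cases hz : ∃ j, E j = 0 ∨ σ j = 0
  · have hzero : ∃ j, ∀ s ∈ P, W j s = 0 := by
      obtain ⟨j, hj⟩ := hz
      obtain ⟨k, hk⟩ := exists_ne j
      rcases hj with hj | hj
      · refine ⟨j, fun s hs => h.eq_zero_of_energy hP hk ?_ hs⟩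
        simpa [hj] using hen j k hk (by simp [hj])
      · refine ⟨j, fun s hs => le_antisymm ?_ (h.nonneg j s)⟩
        have := (h.le_singleton hs hk).trans
          (hsize j k hk (by simp [hj]) s {s} (isKTree_singleton hs k))
        simpa [hj] using this
    obtain ⟨j, hj⟩ := hzero
    rw [Finset.sum_eq_zero fun s hs => by
      rw [weight, Finset.prod_eq_zero (Finset.mem_univ j), mul_zero]
      rw [hj s hs, Real.sqrt_zero]]
    simp
  push Not at hz
  have hE0 : ∀ j, E j ^ (1 - θ j) ≠ 0 := fun j h0 => by
    rcases ENNReal.rpow_eq_zero_iff.1 h0 with h0 | h0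
    · exact (hz j).1 h0.1
    · linarith [h0.2, hθlt j]
  have hσ0 : ∀ j, σ j ^ θ j ≠ 0 := fun j h0 => by
    rcases ENNReal.rpow_eq_zero_iff.1 h0 with h0 | h0
    · exact (hz j).2 h0.1
    · linarith [h0.2, hθ j]
  by_cases ht : ∃ j, E j = ⊤ ∨ σ j = ⊤
  · obtain ⟨j, hj⟩ := ht
    have hjt : E j ^ (1 - θ j) * σ j ^ θ j = ⊤ := by
      rcases hj with hj | hj
      · rw [hj, ENNReal.top_rpow_of_pos (hθlt j), ENNReal.top_mul (hσ0 j)]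
      · rw [hj, ENNReal.top_rpow_of_pos (hθ j), ENNReal.mul_top (hE0 j)]
    have hprod : ∏ j, (E j ^ (1 - θ j) * σ j ^ θ j) = ⊤ := by
      classical
      rw [← Finset.mul_prod_erase _ _ (Finset.mem_univ j), hjt, ENNReal.top_mul]
      exact Finset.prod_ne_zero_iff.2 fun i _ => mul_ne_zero (hE0 i) (hσ0 i)
    rw [hprod, ENNReal.mul_top (by simp)]
    exact le_top
  push Not at ht
  have hreal : ∑ s ∈ P, weight W s ≤
      numClasses A * (C * ∏ j, ((E j).toReal ^ (1 - θ j) * (σ j).toReal ^ θ j)) :=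
    sum_le_of_sparse hgI hgω _ _ fun P₀ hsub h₀ =>
      hle P m W h hP P₀ hsub h₀ _ _ (fun j => ENNReal.toReal_pos (hz j).1 (ht j).1)
        (fun j => ENNReal.toReal_pos (hz j).2 (ht j).2) (fun j k hk => hen j k hk (ht j).1)
        (fun j k hk => hsize j k hk (ht j).2)
  have hconv : ENNReal.ofReal (∏ j, ((E j).toReal ^ (1 - θ j) * (σ j).toReal ^ θ j)) =
      ∏ j, (E j ^ (1 - θ j) * σ j ^ θ j) := by
    rw [ENNReal.ofReal_prod_of_nonneg fun j _ => by positivity]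
    refine Finset.prod_congr rfl fun j _ => ?_
    rw [ENNReal.ofReal_mul (by positivity), ENNReal.toReal_rpow, ENNReal.toReal_rpow,
      ENNReal.ofReal_toReal (ENNReal.rpow_ne_top_of_nonneg (hθlt j).le (ht j).1),
      ENNReal.ofReal_toReal (ENNReal.rpow_ne_top_of_nonneg (hθ j).le (ht j).2)]
  calc _ ≤ _ := ENNReal.ofReal_le_ofReal hreal
    _ = ((numClasses A * C).toNNReal : ℝ≥0∞) * ∏ j, (E j ^ (1 - θ j) * σ j ^ θ j) := by
        rw [← mul_assoc, ENNReal.ofReal_mul (by positivity), hconv]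
        rfl
    _ ≤ _ := by
        gcongr
        simp

end BilinearSquare

namespace BilinearSquare

/-! ### Strips and lattice translates -/

namespace Strips

variable (S : Strips)

theorem a_succ (n : ℤ) : S.a (n + 1) = S.a n + S.period := by
  have hstep : ∀ n, S.a (n + 1) - S.a n = S.a n - S.a (n - 1) := fun n => by
    have := S.len_eq n
    have := S.gap_eq n
    linarith
  have h0 : S.period = S.a (0 + 1) - S.a 0 := by
    simp only [period, L₁, L₂, zero_add]; ring
  induction n using Int.induction_on with
  | zero => linarith
  | succ n ih =>
    have := hstep (n + 1)
    rw [add_sub_cancel_right] at this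
    linarith
  | pred n ih =>
    have := hstep (-n)
    rw [sub_add_cancel]
    linarith

theorem a_eq (n : ℤ) : S.a n = S.a 0 + n * S.period := by
  induction n using Int.induction_on with
  | zero => simp
  | succ n ih =>
    rw [a_succ, ih]; push_cast; ring
  | pred n ih =>
    have := S.a_succ (-n - 1)
    rw [sub_add_cancel, ih] at this
    push_cast at this ⊢
    linarith

theorem b_eq (n : ℤ) : S.b n = S.a n + S.L₁ := by
  have hstep : ∀ n : ℤ, S.b n - S.a n = S.L₁ := by
    intro n
    induction n using Int.induction_on with
    | zero => rfl
    | succ n ih =>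
      have := S.len_eq (n + 1)
      rw [add_sub_cancel_right] at this
      linarith
    | pred n ih =>
      have := S.len_eq (-n)
      linarith
  linarith [hstep n]

theorem L₁_pos : 0 < S.L₁ := sub_pos.2 (S.lt 0)

theorem L₂_nonneg : 0 ≤ S.L₂ := sub_nonneg.2 (by simpa using S.le 0)

theorem period_pos : 0 < S.period := add_pos_of_pos_of_nonneg S.L₁_pos S.L₂_nonneg

end Strips

theorem Ivl.mem_shift_iff (u x : ℝ) (I : Ivl) : x ∈ (I.shift u).toSet ↔ x - u ∈ I.toSet := by
  simp only [toSet, shift, Set.mem_Ico]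
  constructor <;> rintro ⟨h₁, h₂⟩ <;> constructor <;> linarith

theorem Ivl.center_shift (u : ℝ) (I : Ivl) : (I.shift u).center = I.center + u := by
  simp only [center, shift]; ring

theorem Ivl.center_mem (I : Ivl) : I.center ∈ I.toSet := by
  have := I.lt
  simp only [toSet, center, Set.mem_Ico]
  constructor <;> linarith

theorem Ivl.lo_mem (I : Ivl) : I.lo ∈ I.toSet := ⟨le_rfl, I.lt⟩

variable {S : Strips}

theorem InStrip.translate {n : ℤ} {s : TriTile} (h : InStrip S n s) (i j : ℤ) :
    InStrip S (n + (j - i)) (latticeTranslate S i j s) := by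
  intro x hx y hy
  have hx' : x - i * S.period ∈ (s.ω 0).toSet := (Ivl.mem_shift_iff _ _ _).1 hx
  have hy' : y - j * S.period ∈ (s.ω 1).toSet := (Ivl.mem_shift_iff _ _ _).1 hy
  obtain ⟨h₁, h₂⟩ := h _ hx' _ hy'
  rw [S.b_eq, S.a_eq] at h₂ ⊢
  rw [S.a_eq] at h₁
  push_cast
  constructor <;> linarith

theorem InStrip.unique {n n' : ℤ} {s : TriTile} (h : InStrip S n s) (h' : InStrip S n' s) :
    n = n' := by
  have hlt : ∀ {n n' : ℤ}, InStrip S n s → InStrip S n' s → n ≤ n' := by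
    intro n n' h h'
    have h₁ := (h _ (s.ω 0).center_mem _ (s.ω 1).center_mem).1
    have h₂ := (h' _ (s.ω 0).center_mem _ (s.ω 1).center_mem).2
    rw [S.b_eq, S.a_eq] at h₂
    rw [S.a_eq] at h₁
    have hL : S.L₁ ≤ S.period := by
      have := S.L₂_nonneg
      rw [Strips.period]
      linarith
    have h₃ : (n : ℝ) < n' + 1 := by
      by_contra hcon
      have := mul_le_mul_of_nonneg_right (not_lt.1 hcon) S.period_pos.le
      linarith
    have h₄ : n < n' + 1 := by exact_mod_cast h₃
    omega
  exact le_antisymm (hlt h h') (hlt h' h)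

/-- On ω₁ × ω₂ the difference ξ₂ - ξ₁ takes two values that differ by the common frequency length,
and both lie in an open interval of length L₁. -/
theorem InStrip.len_lt {n : ℤ} {s : TriTile} (h : InStrip S n s) (k : Fin 3) :
    (s.ω k).len < S.L₁ := by
  have h₁ := (h _ (s.ω 0).center_mem _ (s.ω 1).lo_mem).1
  have h₂ := (h _ (s.ω 0).lo_mem _ (s.ω 1).center_mem).2
  rw [S.b_eq] at h₂
  rw [Ivl.lo_eq] at h₁ h₂
  have e₀ := s.len_ω 0
  have e₁ := s.len_ω 1
  have e₂ := s.len_ω k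
  rw [e₂]
  rw [e₁] at h₁
  rw [e₀] at h₂
  linarith

theorem mem_strip {Q : Finset TriTile} {n : ℤ} {s : TriTile} :
    s ∈ strip S Q n ↔ s ∈ Q ∧ InStrip S n s := by
  classical
  exact Finset.mem_filter

theorem mem_vec {Q T : Finset TriTile} {k : Fin 3} {s : TriTile} :
    s ∈ vec Q k T ↔ s ∈ Q ∧ ∃ s' ∈ T, s.tile k = s'.tile k := by
  classical
  exact Finset.mem_filter

theorem refSet_subset_strip (S : Strips) (Q : Finset TriTile) : refSet S Q ⊆ strip S Q 0 := by
  classical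
  exact Finset.filter_subset _ _

theorem refSet_subset (S : Strips) (Q : Finset TriTile) : refSet S Q ⊆ Q := fun _ hs =>
  (mem_strip.1 (refSet_subset_strip S Q hs)).1

theorem IsRankOne.mono {P P' : Finset TriTile} (h : IsRankOne P) (hP : P' ⊆ P) : IsRankOne P' :=
  ⟨fun s hs s' hs' => h.tile_ne s (hP hs) s' (hP hs'), fun s hs s' hs' =>
    h.near s (hP hs) s' (hP hs'), fun s hs s' hs' => h.lacunary s (hP hs) s' (hP hs')⟩

theorem IsGrid.mono {A : ℕ} {𝓘 𝓙 : Set Ivl} (h : IsGrid A 𝓘) (hJ : 𝓙 ⊆ 𝓘) : IsGrid A 𝓙 :=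
  fun k x => (Set.encard_le_encard (Set.inter_subset_inter_left _ hJ)).trans (h k x)

/-- `N` bounds the translates that make up the translation complete collection `Q`. -/
def IsTranslationBound (S : Strips) (Q : Finset TriTile) (N : ℕ) : Prop :=
  ∀ s, s ∈ Q ↔ ∃ i ∈ Set.Icc (-(N : ℤ)) N, ∃ j ∈ Set.Icc (-(N : ℤ)) N, ∃ s' ∈ refSet S Q,
    s = latticeTranslate S i j s'

section Translates

variable {Q : Finset TriTile} {N : ℕ}

theorem IsTranslationBound.mem (hN : IsTranslationBound S Q N) {s : TriTile} (hs : s ∈ refSet S Q)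
    {i j : ℤ} (hi : i ∈ Finset.Icc (-(N : ℤ)) N) (hj : j ∈ Finset.Icc (-(N : ℤ)) N) :
    latticeTranslate S i j s ∈ Q :=
  (hN _).2 ⟨i, by simpa using hi, j, by simpa using hj, s, hs, rfl⟩

theorem inStrip_latticeTranslate {s : TriTile} (hs : s ∈ refSet S Q) (i j : ℤ) :
    InStrip S (j - i) (latticeTranslate S i j s) := by
  simpa using (mem_strip.1 (refSet_subset_strip S Q hs)).2.translate i j

theorem IsTranslationBound.exists_eq (hN : IsTranslationBound S Q N) {n : ℤ} {s : TriTile}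
    (hs : s ∈ strip S Q n) : ∃ i ∈ Finset.Icc (-(N : ℤ)) N, ∃ j ∈ Finset.Icc (-(N : ℤ)) N,
      ∃ s' ∈ refSet S Q, s = latticeTranslate S i j s' ∧ n = j - i := by
  obtain ⟨hsQ, hn⟩ := mem_strip.1 hs
  obtain ⟨i, hi, j, hj, s', hs', rfl⟩ := (hN s).1 hsQ
  exact ⟨i, by simpa using hi, j, by simpa using hj, s', hs', rfl,
    hn.unique (inStrip_latticeTranslate hs' i j)⟩

/-- The translate by (i, j) lies in the strip j - i, so only |n| ≤ 2N contribute. The pair (n, s) is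
kept because the coefficient depends on n. -/
theorem IsTranslationBound.tsum_strip (hN : IsTranslationBound S Q N) {X : Finset TriTile}
    (hX : X ⊆ Q) (g : ℤ → TriTile → ℝ) : ∑' n : ℤ, ∑ s ∈ strip S X n, g n s =
      ∑ x ∈ (Finset.Icc (-(2 * N : ℤ)) (2 * N)).sigma (strip S X), g x.1 x.2 := by
  rw [Finset.sum_sigma]
  refine tsum_eq_sum fun n hn => Finset.sum_eq_zero fun s hs => absurd ?_ hn
  obtain ⟨hsX, hsn⟩ := mem_strip.1 hs
  obtain ⟨i, hi, j, hj, -, -, -, rfl⟩ := hN.exists_eq (mem_strip.2 ⟨hX hsX, hsn⟩)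
  rw [Finset.mem_Icc] at hi hj ⊢
  omega

theorem latticeTranslate_tile_zero (i j : ℤ) (s : TriTile) :
    (latticeTranslate S i j s).tile 0 = (latticeTranslate S i 0 s).tile 0 := rfl

theorem latticeTranslate_tile_one (i j : ℤ) (s : TriTile) :
    (latticeTranslate S i j s).tile 1 = (latticeTranslate S 0 j s).tile 1 := rfl

theorem Ivl.shift_zero (I : Ivl) : I.shift 0 = I := by
  ext <;> simp [shift]

theorem latticeTranslate_zero_tile_zero (j : ℤ) (s : TriTile) :
    (latticeTranslate S 0 j s).tile 0 = s.tile 0 := by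
  refine Tile.ext rfl ?_
  change (s.ω 0).shift (((0 : ℤ) : ℝ) * S.period) = s.ω 0
  rw [Int.cast_zero, zero_mul, Ivl.shift_zero]

theorem latticeTranslate_zero_tile_one (i : ℤ) (s : TriTile) :
    (latticeTranslate S i 0 s).tile 1 = s.tile 1 := by
  refine Tile.ext rfl ?_
  change (s.ω 1).shift (((0 : ℤ) : ℝ) * S.period) = s.ω 1
  rw [Int.cast_zero, zero_mul, Ivl.shift_zero]

theorem center_latticeTranslate_zero (i j : ℤ) (s : TriTile) :
    ((latticeTranslate S i j s).ω 0).center = (s.ω 0).center + i * S.period :=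
  Ivl.center_shift _ _

theorem center_latticeTranslate_one (i j : ℤ) (s : TriTile) :
    ((latticeTranslate S i j s).ω 1).center = (s.ω 1).center + j * S.period :=
  Ivl.center_shift _ _

theorem latticeTranslate_injective (i j : ℤ) : Function.Injective (latticeTranslate S i j) := by
  intro s s' h
  have hI : (latticeTranslate S i j s).I = (latticeTranslate S i j s').I := congrArg TriTile.I h
  refine TriTile.ext hI (funext fun l => ?_)
  have h₁ := congrFun (congrArg TriTile.ω h) l
  simp only [latticeTranslate, TriTile.translate] at h₁
  have h₂ := congrArg Ivl.lo h₁
  have h₃ := congrArg Ivl.hi h₁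
  exact Ivl.ext (add_right_cancel h₂) (add_right_cancel h₃)

theorem int_eq_of_mul_period {i j : ℤ} (h : (i : ℝ) * S.period = j * S.period) : i = j := by
  exact_mod_cast mul_right_cancel₀ S.period_pos.ne' h

/-- The coefficients of the orbits of the tri-tiles of the reference set. -/
noncomputable def orbitMass (S : Strips) (Φ : Packets) (N : ℕ) (f g : ℝ → ℂ) (h : ℤ → ℝ → ℂ) :
    Fin 3 → TriTile → ℝ :=
  ![fun s => ∑ i ∈ Finset.Icc (-(N : ℤ)) N,
      ‖pairing f (Φ 0 ((latticeTranslate S i 0 s).tile 0))‖ ^ 2,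
    fun s => ∑ j ∈ Finset.Icc (-(N : ℤ)) N,
      ‖pairing g (Φ 1 ((latticeTranslate S 0 j s).tile 1))‖ ^ 2,
    fun s => ∑ p ∈ Finset.Icc (-(N : ℤ)) N ×ˢ Finset.Icc (-(N : ℤ)) N,
      ‖pairing (h (p.2 - p.1)) (Φ 2 ((latticeTranslate S p.1 p.2 s).tile 2))‖ ^ 2]

/-- The masses of the vectorized trees. -/
noncomputable def treeMass (S : Strips) (Φ : Packets) (Q : Finset TriTile) (f g : ℝ → ℂ)
    (h : ℤ → ℝ → ℂ) : Fin 3 → Finset TriTile → ℝ :=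
  ![mass Φ Q 0 1 f, mass Φ Q 1 0 g, mass₃ S Φ Q h]

/-- The form is dominated by the sum of the orbit contributions over the reference set. -/
theorem form_le_sum_weight (hN : IsTranslationBound S Q N) (Φ : Packets) (f g : ℝ → ℂ)
    (h : ℤ → ℝ → ℂ) :
    form S Φ Q f g h ≤ ∑ s ∈ refSet S Q, weight (orbitMass S Φ N f g h) s := by
  classical
  set J := Finset.Icc (-(N : ℤ)) N with hJ
  set c : ℤ → TriTile → ℝ := fun n s => s.I.len ^ (-(1 / 2) : ℝ) *
    ‖pairing f (Φ 0 (s.tile 0)) * pairing g (Φ 1 (s.tile 1)) * pairing (h n) (Φ 2 (s.tile 2))‖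
    with hc
  have hc0 : ∀ n s, 0 ≤ c n s := fun n s =>
    mul_nonneg (Real.rpow_nonneg s.I.len_pos.le _) (norm_nonneg _)
  let φ : TriTile × (ℤ × ℤ) → (_ : ℤ) × TriTile := fun p =>
    ⟨p.2.2 - p.2.1, latticeTranslate S p.2.1 p.2.2 p.1⟩
  rw [form, hN.tsum_strip subset_rfl c]
  calc _ ≤ ∑ x ∈ (refSet S Q ×ˢ (J ×ˢ J)).image φ, c x.1 x.2 := by
        refine Finset.sum_le_sum_of_subset_of_nonneg ?_ fun x _ _ => hc0 _ _
        rintro ⟨n, s⟩ hx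
        obtain ⟨i, hi, j, hj, s', hs', rfl, rfl⟩ := hN.exists_eq (Finset.mem_sigma.1 hx).2
        exact Finset.mem_image.2 ⟨(s', i, j), Finset.mem_product.2
          ⟨hs', Finset.mem_product.2 ⟨hi, hj⟩⟩, rfl⟩
    -- Different triples may give the same tri-tile; the terms are nonnegative, so this loses
    -- nothing needed.
    _ ≤ ∑ p ∈ refSet S Q ×ˢ (J ×ˢ J), c (φ p).1 (φ p).2 :=
        Finset.sum_image_le_of_nonneg (f := fun x : (_ : ℤ) × TriTile => c x.1 x.2)
          fun x _ => hc0 _ _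
    _ = ∑ s ∈ refSet S Q, ∑ p ∈ J ×ˢ J, c (p.2 - p.1) (latticeTranslate S p.1 p.2 s) :=
        Finset.sum_product _ _ _
    _ ≤ _ := Finset.sum_le_sum fun s _ => ?_
  set u : ℤ → ℝ := fun i => ‖pairing f (Φ 0 ((latticeTranslate S i 0 s).tile 0))‖ with hu
  set v : ℤ → ℝ := fun j => ‖pairing g (Φ 1 ((latticeTranslate S 0 j s).tile 1))‖ with hv
  set w : ℤ × ℤ → ℝ := fun p =>
    ‖pairing (h (p.2 - p.1)) (Φ 2 ((latticeTranslate S p.1 p.2 s).tile 2))‖ with hw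
  have hW : weight (orbitMass S Φ N f g h) s = s.I.len ^ (-(1 / 2) : ℝ) *
      (√(∑ i ∈ J, u i ^ 2) * √(∑ j ∈ J, v j ^ 2) * √(∑ p ∈ J ×ˢ J, w p ^ 2)) := by
    rw [weight, Fin.prod_univ_three]
    rfl
  have hterm : ∀ p : ℤ × ℤ, c (p.2 - p.1) (latticeTranslate S p.1 p.2 s) =
      s.I.len ^ (-(1 / 2) : ℝ) * (u p.1 * v p.2 * w p) := by
    intro p
    simp only [hc, norm_mul]
    rw [latticeTranslate_tile_zero, latticeTranslate_tile_one]
    rfl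
  rw [hW, Finset.sum_congr rfl fun p _ => hterm p, ← Finset.mul_sum]
  refine mul_le_mul_of_nonneg_left ?_ (Real.rpow_nonneg s.I.len_pos.le _)
  -- Cauchy–Schwarz in (i, j); the sum of the squares of u_i v_j factors.
  refine (Real.sum_mul_le_sqrt_mul_sqrt (J ×ˢ J) (fun p => u p.1 * v p.2) w).trans_eq ?_
  have huv : ∑ p ∈ J ×ˢ J, (u p.1 * v p.2) ^ 2 = (∑ i ∈ J, u i ^ 2) * ∑ j ∈ J, v j ^ 2 := by
    rw [Finset.sum_mul_sum, Finset.sum_product]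
    exact Finset.sum_congr rfl fun i _ => Finset.sum_congr rfl fun j _ => mul_pow (u i) (v j) 2
  rw [huv, Real.sqrt_mul (Finset.sum_nonneg fun i _ => sq_nonneg (u i))]

/-! ### Vectorized trees: subadditivity of the masses and comparison with orbits -/

theorem sum_le_add_of_subset_union {ι : Type*} [DecidableEq ι] {X Y Z : Finset ι}
    (h : X ⊆ Y ∪ Z) {F : ι → ℝ} (hF : ∀ i, 0 ≤ F i) :
    ∑ i ∈ X, F i ≤ ∑ i ∈ Y, F i + ∑ i ∈ Z, F i := by
  have h₁ := Finset.sum_le_sum_of_subset_of_nonneg h fun i _ _ => hF i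
  have h₂ := Finset.sum_union_inter (s₁ := Y) (s₂ := Z) (f := F)
  have h₃ := Finset.sum_nonneg fun i (_ : i ∈ Y ∩ Z) => hF i
  linarith

theorem vec_union_subset [DecidableEq TriTile] (Q : Finset TriTile) (k : Fin 3)
    (T T' : Finset TriTile) : vec Q k (T ∪ T') ⊆ vec Q k T ∪ vec Q k T' := by
  intro s hs
  obtain ⟨hsQ, s', hs', he⟩ := mem_vec.1 hs
  rcases Finset.mem_union.1 hs' with h | h
  · exact Finset.mem_union_left _ (mem_vec.2 ⟨hsQ, s', h, he⟩)
  · exact Finset.mem_union_right _ (mem_vec.2 ⟨hsQ, s', h, he⟩)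

theorem vec_mono (Q : Finset TriTile) (k : Fin 3) {T T' : Finset TriTile} (h : T ⊆ T') :
    vec Q k T ⊆ vec Q k T' := fun _ hs => by
  obtain ⟨hsQ, s', hs', he⟩ := mem_vec.1 hs
  exact mem_vec.2 ⟨hsQ, s', h hs', he⟩

theorem vec_empty (Q : Finset TriTile) (k : Fin 3) : vec Q k ∅ = ∅ :=
  Finset.eq_empty_of_forall_notMem fun s hs => by
    obtain ⟨-, s', hs', -⟩ := mem_vec.1 hs
    simp at hs'

theorem vec₁₂_subset (Q T : Finset TriTile) : vec₁₂ Q T ⊆ Q := fun _ hs => (mem_vec.1 hs).1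

theorem IsTranslationBound.mass₃_eq (hN : IsTranslationBound S Q N) (Φ : Packets)
    (h : ℤ → ℝ → ℂ) (T : Finset TriTile) : mass₃ S Φ Q h T =
      ∑ x ∈ (Finset.Icc (-(2 * N : ℤ)) (2 * N)).sigma (strip S (vec₁₂ Q T)),
        ‖pairing (h x.1) (Φ 2 (x.2.tile 2))‖ ^ 2 :=
  hN.tsum_strip (vec₁₂_subset Q T) fun n s => ‖pairing (h n) (Φ 2 (s.tile 2))‖ ^ 2

theorem mass_union_le [DecidableEq TriTile] (Φ : Packets) (Q : Finset TriTile) (j l : Fin 3)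
    (f : ℝ → ℂ) (T T' : Finset TriTile) :
    mass Φ Q j l f (T ∪ T') ≤ mass Φ Q j l f T + mass Φ Q j l f T' :=
  sum_le_add_of_subset_union (vec_union_subset Q l T T') fun _ => sq_nonneg _

theorem IsTranslationBound.mass₃_union_le [DecidableEq TriTile] (hN : IsTranslationBound S Q N)
    (Φ : Packets) (h : ℤ → ℝ → ℂ) (T T' : Finset TriTile) :
    mass₃ S Φ Q h (T ∪ T') ≤ mass₃ S Φ Q h T + mass₃ S Φ Q h T' := by
  rw [hN.mass₃_eq, hN.mass₃_eq, hN.mass₃_eq]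
  refine sum_le_add_of_subset_union ?_ fun _ => sq_nonneg _
  rintro ⟨n, s⟩ hx
  obtain ⟨hn, hs⟩ := Finset.mem_sigma.1 hx
  obtain ⟨hs, hin⟩ := mem_strip.1 hs
  have := (vec_mono Q 1 (vec_union_subset Q 0 T T')).trans (vec_union_subset Q 1 _ _) hs
  rcases Finset.mem_union.1 this with h | h
  · exact Finset.mem_union_left _ (Finset.mem_sigma.2 ⟨hn, mem_strip.2 ⟨h, hin⟩⟩)
  · exact Finset.mem_union_right _ (Finset.mem_sigma.2 ⟨hn, mem_strip.2 ⟨h, hin⟩⟩)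

/-- Translation by (i, 0) moves the first tile and keeps the second. The translates therefore lie in
the 2-vectorized tree, and the second tile recovers s by rank one. The center of the first frequency
then recovers i. -/
theorem sum_orbit_zero_le (hP : IsRankOne (refSet S Q)) (hN : IsTranslationBound S Q N)
    (Φ : Packets) (f : ℝ → ℂ) {T : Finset TriTile} (hT : T ⊆ refSet S Q) :
    ∑ s ∈ T, ∑ i ∈ Finset.Icc (-(N : ℤ)) N,
      ‖pairing f (Φ 0 ((latticeTranslate S i 0 s).tile 0))‖ ^ 2 ≤ mass Φ Q 0 1 f T := by
  classical
  let φ : TriTile × ℤ → TriTile := fun p => latticeTranslate S p.2 0 p.1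
  have hinj : Set.InjOn φ (T ×ˢ Finset.Icc (-(N : ℤ)) N : Finset (TriTile × ℤ)) := by
    rintro ⟨s, i⟩ hp ⟨s', i'⟩ hp' heq
    have hs := hT (Finset.mem_product.1 (Finset.mem_coe.1 hp)).1
    have hs' := hT (Finset.mem_product.1 (Finset.mem_coe.1 hp')).1
    change latticeTranslate S i 0 s = latticeTranslate S i' 0 s' at heq
    have hse : s = s' := by
      by_contra hne
      refine hP.tile_ne s hs s' hs' hne 1 ?_
      rw [← latticeTranslate_zero_tile_one (S := S) i s, heq, latticeTranslate_zero_tile_one]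
    subst hse
    have hc := congrArg (fun x : TriTile => (x.ω 0).center) heq
    simp only [center_latticeTranslate_zero] at hc
    rw [int_eq_of_mul_period (add_left_cancel hc)]
  rw [← Finset.sum_product (f := fun p : TriTile × ℤ =>
      ‖pairing f (Φ 0 ((latticeTranslate S p.2 0 p.1).tile 0))‖ ^ 2),
    ← Finset.sum_image (f := fun s : TriTile => ‖pairing f (Φ 0 (s.tile 0))‖ ^ 2) (g := φ) hinj]
  refine Finset.sum_le_sum_of_subset_of_nonneg (fun s hs => ?_) fun _ _ _ => sq_nonneg _
  obtain ⟨⟨s', i⟩, hp, rfl⟩ := Finset.mem_image.1 hs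
  obtain ⟨hs', hi⟩ := Finset.mem_product.1 hp
  exact mem_vec.2 ⟨hN.mem (hT hs') hi (by simp), s', hs', latticeTranslate_zero_tile_one i s'⟩

theorem sum_orbit_one_le (hP : IsRankOne (refSet S Q)) (hN : IsTranslationBound S Q N)
    (Φ : Packets) (g : ℝ → ℂ) {T : Finset TriTile} (hT : T ⊆ refSet S Q) :
    ∑ s ∈ T, ∑ j ∈ Finset.Icc (-(N : ℤ)) N,
      ‖pairing g (Φ 1 ((latticeTranslate S 0 j s).tile 1))‖ ^ 2 ≤ mass Φ Q 1 0 g T := by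
  classical
  let φ : TriTile × ℤ → TriTile := fun p => latticeTranslate S 0 p.2 p.1
  have hinj : Set.InjOn φ (T ×ˢ Finset.Icc (-(N : ℤ)) N : Finset (TriTile × ℤ)) := by
    rintro ⟨s, i⟩ hp ⟨s', i'⟩ hp' heq
    have hs := hT (Finset.mem_product.1 (Finset.mem_coe.1 hp)).1
    have hs' := hT (Finset.mem_product.1 (Finset.mem_coe.1 hp')).1
    change latticeTranslate S 0 i s = latticeTranslate S 0 i' s' at heq
    have hse : s = s' := by
      by_contra hne
      refine hP.tile_ne s hs s' hs' hne 0 ?_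
      rw [← latticeTranslate_zero_tile_zero (S := S) i s, heq, latticeTranslate_zero_tile_zero]
    subst hse
    have hc := congrArg (fun x : TriTile => (x.ω 1).center) heq
    simp only [center_latticeTranslate_one] at hc
    rw [int_eq_of_mul_period (add_left_cancel hc)]
  rw [← Finset.sum_product (f := fun p : TriTile × ℤ =>
      ‖pairing g (Φ 1 ((latticeTranslate S 0 p.2 p.1).tile 1))‖ ^ 2),
    ← Finset.sum_image (f := fun s : TriTile => ‖pairing g (Φ 1 (s.tile 1))‖ ^ 2) (g := φ) hinj]
  refine Finset.sum_le_sum_of_subset_of_nonneg (fun s hs => ?_) fun _ _ _ => sq_nonneg _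
  obtain ⟨⟨s', i⟩, hp, rfl⟩ := Finset.mem_image.1 hs
  obtain ⟨hs', hi⟩ := Finset.mem_product.1 hp
  exact mem_vec.2 ⟨hN.mem (hT hs') (by simp) hi, s', hs', latticeTranslate_zero_tile_zero i s'⟩

/-- Tri-tiles of a `k`-tree of the reference set, `k ≠ 3`, have disjoint orbits if the gaps
between the strips are large. -/
theorem IsKTree.orbit_injective (hκ : 2 * S.L₁ ≤ S.L₂) {k : Fin 3} (hk : k ≠ 2) {t : TriTile}
    {T : Finset TriTile} (hT : IsKTree (refSet S Q) k t T) {s s' : TriTile} (hs : s ∈ T)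
    (hs' : s' ∈ T) {i j i' j' : ℤ} (hn : j - i = j' - i')
    (heq : latticeTranslate S i j s = latticeTranslate S i' j' s') :
    s = s' ∧ i = i' ∧ j = j' := by
  have h₀ := congrArg (fun x : TriTile => (x.ω 0).center) heq
  have h₁ := congrArg (fun x : TriTile => (x.ω 1).center) heq
  simp only [center_latticeTranslate_zero, center_latticeTranslate_one] at h₀ h₁
  -- Lying in the same strip means i - i' = j - j', so for k = 1 and k = 2 alike the shift is the
  -- same multiple of L.
  have hd : (s'.ω k).center - (s.ω k).center = (i - i' : ℤ) * S.period := by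
    have hij : j = i - i' + j' := by omega
    rw [hij] at h₁
    push_cast at h₁ ⊢
    fin_cases k
    · simp only [Fin.zero_eta]
      linarith
    · simp only [Fin.mk_one]
      linarith
    · exact absurd rfl hk
  have c₁ := TriTile.abs_center_le_of_belowEq (hT.belowEq s hs)
  have c₂ := TriTile.abs_center_le_of_belowEq (hT.belowEq s' hs')
  have htri := abs_sub_le (s'.ω k).center (t.ω k).center (s.ω k).center
  rw [abs_sub_comm (s'.ω k).center (t.ω k).center, hd, abs_mul,
    abs_of_pos S.period_pos] at htri
  have hlen : ∀ s ∈ T, (s.ω k).len < S.L₁ := fun s hs =>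
    (mem_strip.1 (refSet_subset_strip S Q (hT.subset hs))).2.len_lt k
  have l₁ := hlen s hs
  have l₂ := hlen s' hs'
  have l₃ := (t.ω k).len_pos
  -- Each center is within 3/2 L₁ of that of the top, so the two differ by less than 3 L₁ ≤ L and
  -- the multiple is zero. This fixes the admissible κ.
  have hper : 3 * S.L₁ ≤ S.period := by
    rw [Strips.period]
    linarith
  have hi : i - i' = 0 := by
    by_contra hne
    have h1 : (1 : ℝ) ≤ |((i - i' : ℤ) : ℝ)| := by
      exact_mod_cast Int.one_le_abs hne
    have := mul_le_mul_of_nonneg_right h1 S.period_pos.le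
    linarith
  have hi' : i = i' := by omega
  have hj' : j = j' := by omega
  subst hi' hj'
  exact ⟨latticeTranslate_injective i j heq, rfl, rfl⟩

theorem sum_orbit_two_le (hκ : 2 * S.L₁ ≤ S.L₂) (hN : IsTranslationBound S Q N)
    (Φ : Packets) (h : ℤ → ℝ → ℂ) {k : Fin 3} (hk : k ≠ 2) {t : TriTile}
    {T : Finset TriTile} (hT : IsKTree (refSet S Q) k t T) :
    ∑ s ∈ T, ∑ p ∈ Finset.Icc (-(N : ℤ)) N ×ˢ Finset.Icc (-(N : ℤ)) N,
      ‖pairing (h (p.2 - p.1)) (Φ 2 ((latticeTranslate S p.1 p.2 s).tile 2))‖ ^ 2 ≤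
        mass₃ S Φ Q h T := by
  classical
  set J := Finset.Icc (-(N : ℤ)) N with hJ
  let φ : TriTile × (ℤ × ℤ) → (_ : ℤ) × TriTile := fun p =>
    ⟨p.2.2 - p.2.1, latticeTranslate S p.2.1 p.2.2 p.1⟩
  have hinj : Set.InjOn φ (T ×ˢ (J ×ˢ J) : Finset (TriTile × (ℤ × ℤ))) := by
    rintro ⟨s, i, j⟩ hp ⟨s', i', j'⟩ hp' heq
    have hs := (Finset.mem_product.1 (Finset.mem_coe.1 hp)).1
    have hs' := (Finset.mem_product.1 (Finset.mem_coe.1 hp')).1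
    simp only [φ, Sigma.mk.injEq, heq_eq_eq] at heq
    obtain ⟨rfl, rfl, rfl⟩ := hT.orbit_injective hκ hk hs hs' heq.1 heq.2
    rfl
  rw [hN.mass₃_eq, ← Finset.sum_product (f := fun p : TriTile × (ℤ × ℤ) =>
      ‖pairing (h (p.2.2 - p.2.1)) (Φ 2 ((latticeTranslate S p.2.1 p.2.2 p.1).tile 2))‖ ^ 2),
    ← Finset.sum_image (f := fun x : (_ : ℤ) × TriTile =>
      ‖pairing (h x.1) (Φ 2 (x.2.tile 2))‖ ^ 2) (g := φ) hinj]
  refine Finset.sum_le_sum_of_subset_of_nonneg (fun x hx => ?_) fun _ _ _ => sq_nonneg _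
  obtain ⟨⟨s, i, j⟩, hp, rfl⟩ := Finset.mem_image.1 hx
  obtain ⟨hs, hij⟩ := Finset.mem_product.1 hp
  obtain ⟨hi, hj⟩ := Finset.mem_product.1 hij
  have hsP := hT.subset hs
  -- The translate by (0, j) shares its first tile with s, and the translate by (i, j) shares its
  -- second tile with that one. So the whole orbit lies in the (1,2)-vectorized tree.
  refine Finset.mem_sigma.2 ⟨?_, mem_strip.2 ⟨mem_vec.2 ⟨hN.mem hsP hi hj,
    latticeTranslate S 0 j s, mem_vec.2 ⟨hN.mem hsP (by simp) hj, s, hs,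
      latticeTranslate_zero_tile_zero j s⟩, latticeTranslate_tile_one i j s⟩,
    inStrip_latticeTranslate hsP i j⟩⟩
  simp only [hJ, Finset.mem_Icc] at hi hj
  simp only [φ, Finset.mem_Icc]
  omega

theorem isTreeMass_orbitMass (hκ : 2 * S.L₁ ≤ S.L₂) (hP : IsRankOne (refSet S Q))
    (hN : IsTranslationBound S Q N) (Φ : Packets) (f g : ℝ → ℂ) (h : ℤ → ℝ → ℂ) :
    IsTreeMass (refSet S Q) (treeMass S Φ Q f g h) (orbitMass S Φ N f g h) where
  empty j := by
    fin_cases j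
    · simp [treeMass, mass, vec_empty]
    · simp [treeMass, mass, vec_empty]
    · change mass₃ S Φ Q h ∅ = 0
      rw [hN.mass₃_eq, vec₁₂, vec_empty, vec_empty]
      exact Finset.sum_eq_zero fun x hx => absurd
        (mem_strip.1 (Finset.mem_sigma.1 hx).2).1 (Finset.notMem_empty _)
  union j T T' := by
    fin_cases j
    · exact mass_union_le Φ Q 0 1 f T T'
    · exact mass_union_le Φ Q 1 0 g T T'
    · exact hN.mass₃_union_le Φ h T T'
  nonneg j s := by
    fin_cases j
    · exact Finset.sum_nonneg (s := Finset.Icc (-(N : ℤ)) N) fun i _ => sq_nonneg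
        ‖pairing f (Φ 0 ((latticeTranslate S i 0 s).tile 0))‖
    · exact Finset.sum_nonneg (s := Finset.Icc (-(N : ℤ)) N) fun j _ => sq_nonneg
        ‖pairing g (Φ 1 ((latticeTranslate S 0 j s).tile 1))‖
    · exact Finset.sum_nonneg fun p _ => sq_nonneg
        ‖pairing (h (p.2 - p.1)) (Φ 2 ((latticeTranslate S p.1 p.2 s).tile 2))‖
  sum_le j k hk t T hT := by
    fin_cases j
    · exact sum_orbit_zero_le hP hN Φ f hT.subset
    · exact sum_orbit_one_le hP hN Φ g hT.subset
    · exact sum_orbit_two_le hκ hN Φ h hk hT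

/-! ### Sizes and energies as bounds for trees of the reference set -/

theorem IsKTree.isTree {k : Fin 3} {t : TriTile} {T : Finset TriTile}
    (h : IsKTree (refSet S Q) k t T) {P : Finset TriTile} (hP : refSet S Q ⊆ P) :
    IsTree S P k t T := by
  have hmem : ∀ s ∈ refSet S Q, s ∈ strip S P 0 := fun s hs =>
    mem_strip.2 ⟨hP hs, (mem_strip.1 (refSet_subset_strip S Q hs)).2⟩
  exact ⟨0, hmem t h.top_mem, fun s hs => hmem s (h.subset hs), h.belowEq⟩

theorem IsTree.isKTree {k : Fin 3} {t : TriTile} {T P : Finset TriTile}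
    (h : IsTree S P k t T) : IsKTree P k t T := by
  obtain ⟨n, ht, hT, hb⟩ := h
  exact ⟨(mem_strip.1 ht).1, fun s hs => (mem_strip.1 (hT hs)).1, hb⟩

theorem le_treeSup_sq {P : Finset TriTile} {j k : Fin 3} (hk : k ≠ j) {m : Finset TriTile → ℝ}
    (htop : treeSup S P j m ≠ ⊤) {t : TriTile} {T : Finset TriTile} (hT : IsTree S P k t T) :
    m T ≤ (treeSup S P j m).toReal ^ 2 * t.I.len := by
  have h₁ : ENNReal.ofReal (√(t.I.len⁻¹ * m T)) ≤ treeSup S P j m :=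
    le_iSup_of_le k (le_iSup_of_le hk (le_iSup_of_le t (le_iSup_of_le T (le_iSup_of_le hT le_rfl))))
  have h₂ := (Real.sqrt_le_left ENNReal.toReal_nonneg).1 ((ENNReal.ofReal_le_iff_le_toReal htop).1 h₁)
  rwa [inv_mul_le_iff₀ t.I.len_pos, mul_comm] at h₂

theorem energyBound_treeEnergy {j k : Fin 3} (hk : k ≠ j) {m : Finset TriTile → ℝ}
    (htop : treeEnergy S Q j m ≠ ⊤) :
    EnergyBound (refSet S Q) j k m ((treeEnergy S Q j m).toReal ^ 2) := by
  intro r D hD hdisj hlow hup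
  have h4 : ∀ r : ℤ, (4 : ℝ) ^ r = 2 ^ (2 * r) := fun r => by
    rw [zpow_mul]; norm_num
  have hfam : IsEnergyFamily S Q j k m r D :=
    ⟨fun p hp => (hD p hp).isTree subset_rfl, hdisj, fun p hp => by
      rw [← h4]; exact hlow p hp, fun p hp t' T' hT' ht' => by
      have := hup p hp t' T' hT' ht'.isKTree
      rwa [h4, mul_add] at this⟩
  have h₁ : ENNReal.ofReal ((2 : ℝ) ^ r * √(∑ p ∈ D, p.1.I.len)) ≤ treeEnergy S Q j m :=
    le_iSup_of_le k (le_iSup_of_le hk (le_iSup_of_le r (le_iSup_of_le D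
      (le_iSup_of_le hfam le_rfl))))
  have h₂ := pow_le_pow_left₀ (by positivity) ((ENNReal.ofReal_le_iff_le_toReal htop).1 h₁) 2
  rw [mul_pow, Real.sq_sqrt (Finset.sum_nonneg fun p _ => p.1.I.len_pos.le)] at h₂
  refine le_of_eq_of_le ?_ h₂
  rw [h4, mul_comm 2 r, zpow_mul]
  norm_cast

end Translates

end BilinearSquare

/-! ### Proof of the theorem -/

theorem mainTheorem7 (A : ℕ) (B : ℝ) :
    ∃ κ : ℝ, ∀ θ₁ θ₂ θ₃ : ℝ, 0 < θ₁ → 0 < θ₂ → 0 < θ₃ → θ₁ + θ₂ + θ₃ = 1 →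
      ∃ C : ℝ≥0, ∀ (S : Strips), κ * S.L₁ ≤ S.L₂ →
        ∀ (Q : Finset TriTile), IsCollection S A B Q → (∀ n, IsRankOne (strip S Q n)) →
          IsTranslationComplete S Q →
        ∀ (K : ℕ → ℕ → ℝ) (Φ : Packets),
          (∀ s ∈ Q, ∀ j, IsWavePacket K (s.tile j) (Φ j (s.tile j))) →
        ∀ (f₁ f₂ : ℝ → ℂ) (f₃ : ℤ → ℝ → ℂ),
          (∀ s ∈ Q, Pairable f₁ (Φ 0 (s.tile 0))) →
          (∀ s ∈ Q, Pairable f₂ (Φ 1 (s.tile 1))) →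
          (∀ n, ∀ s ∈ strip S Q n, Pairable (f₃ n) (Φ 2 (s.tile 2))) →
          ENNReal.ofReal (form S Φ Q f₁ f₂ f₃) ≤
            C * (vecEnergy S Φ Q 0 1 f₁ ^ (1 - θ₁) * vecSize S Φ Q 0 1 f₁ ^ θ₁)
              * (vecEnergy S Φ Q 1 0 f₂ ^ (1 - θ₂) * vecSize S Φ Q 1 0 f₂ ^ θ₂)
              * (vecEnergy₃ S Φ Q f₃ ^ (1 - θ₃) * vecSize₃ S Φ Q f₃ ^ θ₃) := by
  refine ⟨2, fun θ₁ θ₂ θ₃ h₁ h₂ h₃ hsum => ?_⟩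
  obtain ⟨C, hC⟩ := exists_ofReal_sum_weight_le A (θ := ![θ₁, θ₂, θ₃])
    (fun j => by fin_cases j <;> assumption) (by simpa [Fin.sum_univ_three] using hsum)
  refine ⟨C, fun S hκ Q hQ hrank hcomplete K Φ _ f₁ f₂ f₃ _ _ _ => ?_⟩
  obtain ⟨N, hN⟩ := hcomplete
  have hN' : IsTranslationBound S Q N := hN
  have hP : IsRankOne (refSet S Q) := (hrank 0).mono (refSet_subset_strip S Q)
  have hmain := hC (refSet S Q) _ _ (isTreeMass_orbitMass hκ hP hN' Φ f₁ f₂ f₃) hP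
    (hQ.grid_space.mono fun I ⟨s, hs, hI⟩ => ⟨s, refSet_subset S Q hs, hI⟩)
    (hQ.grid_freq.mono fun I ⟨s, hs, hI⟩ => ⟨s, refSet_subset S Q hs, hI⟩)
    ![vecEnergy S Φ Q 0 1 f₁, vecEnergy S Φ Q 1 0 f₂, vecEnergy₃ S Φ Q f₃]
    ![vecSize S Φ Q 0 1 f₁, vecSize S Φ Q 1 0 f₂, vecSize₃ S Φ Q f₃]
    (fun j k hk htop => by
      fin_cases j
      · exact energyBound_treeEnergy hk htop
      · exact energyBound_treeEnergy hk htop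
      · exact energyBound_treeEnergy hk htop)
    -- The first two sizes are suprema over trees of Q, the third over trees of the reference set
    -- only; a tree of the reference set enters all of them.
    (fun j k hk htop t T hT => by
      fin_cases j
      · exact le_treeSup_sq hk htop (hT.isTree (refSet_subset S Q))
      · exact le_treeSup_sq hk htop (hT.isTree (refSet_subset S Q))
      · exact le_treeSup_sq hk htop (hT.isTree subset_rfl))
  refine ((ENNReal.ofReal_le_ofReal (form_le_sum_weight hN' Φ f₁ f₂ f₃)).trans hmain).trans_eq ?_
  rw [Fin.prod_univ_three, ← mul_assoc, ← mul_assoc (C : ℝ≥0∞)]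
  rfl
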